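/- For $k,N>0$ with $k+N>1$ and $z\in\mathbb{C}\setminus(-\infty,0]$ let $$\mathscr{F}_{k,N}(z):=\sum_{n=1}^{\infty}\frac{\psi(n^{N}z)-\log(n^{N}z)}{n^{k}},$$ where $\psi=\Gamma'/\Gamma$ is the digamma function and $\log$ is the principal branch of the logarithm. Let $\gamma$ be Euler's constant and $\gamma_1$ the first Stieltjes constant, so that $\zeta(s)=\frac{1}{s-1}+\gamma-\gamma_1(s-1)+O((s-1)^2)$ as $s\to1$. Powers take their principal values, and $\sum''_{j}$ denotes the sum over $j=-(N-1),-(N-3),\dots,N-3,N-1$. **Theorem.** Let $N$ be an odd natural number and let $x\in\mathbb{C}$ with $\operatorname{Re}(x)>0$. Then all the series $\mathscr{F}$ below converge absolutely, and $$\sum_{j=-(N-1)}^{N-1}{}^{''}\left\{\mathscr{F}_{1,\frac1N}\!\left(i\left(\tfrac{2\pi}{x}\right)^{\frac1N}e^{\frac{i\pi j}{2N}}\right)+\mathscr{F}_{1,\frac1N}\!\left(-i\left(\tfrac{2\pi}{x}\right)^{\frac1N}e^{\frac{i\pi j}{2N}}\right)\right\}$$ $$=-N\left\{\mathscr{F}_{1,N}\!\left(\tfrac{ix}{2\pi}\right)+\mathscr{F}_{1,N}\!\left(-\tfrac{ix}{2\pi}\right)-\frac1N\left(\frac{\pi^2}{12}-2N\gamma^2+2(N-1)\gamma\log\left(\frac{2\pi}{x}\right)+\log^2(2\pi)-\log\left(\frac{4\pi^2}{x}\right)\log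 x-2(N^2+1)\gamma_1\right)\right\}.$$ -/

import Mathlib

/-- The `n`-th term (`n ≥ 1`) of the series defining the extended higher Herglotz function:
`(ψ(n ^ N * x) - log (n ^ N * x)) / n ^ k`, where `ψ` is the digamma function, `log` is the
principal branch, and `n ^ N`, `n ^ k` are positive real powers. -/
noncomputable def herglotzTerm (k N : ℝ) (x : ℂ) (n : ℕ) : ℂ :=
  (Complex.digamma (((n : ℝ) ^ N : ℝ) * x) - Complex.log (((n : ℝ) ^ N : ℝ) * x)) /
    ((n : ℝ) ^ k : ℝ)

/-- The extended higher Herglotz function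
`𝓕_{k,N}(x) = ∑_{n ≥ 1} (ψ(n ^ N * x) - log (n ^ N * x)) / n ^ k`. -/
noncomputable def extHerglotz (k N : ℝ) (x : ℂ) : ℂ :=
  ∑' n : ℕ, herglotzTerm k N x (n + 1)

/-- The first Stieltjes constant `γ₁`, determined by the Laurent expansion
`ζ(s) = 1 / (s - 1) + γ - γ₁ * (s - 1) + O((s - 1) ^ 2)` at `s = 1`; Mathlib's `riemannZeta₀` is
the entire function `ζ(s) - 1 / (s - 1)`. -/
noncomputable def stieltjesOne : ℂ := -deriv riemannZeta₀ 1

/-- The sum of `f j` over `j = -(N - 1), -(N - 3), …, N - 3, N - 1`. -/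
noncomputable def stepTwoSum (N : ℕ) (f : ℤ → ℂ) : ℂ :=
  ∑ m ∈ Finset.range N, f (2 * (m : ℤ) - ((N : ℤ) - 1))

/-- The point `(2 * π / x) ^ (1 / N) * e ^ (i * π * j / (2 * N))`, with the principal power. -/
noncomputable def rootPoint (N : ℕ) (x : ℂ) (j : ℤ) : ℂ :=
  (2 * (Real.pi : ℂ) / x) ^ (1 / (N : ℂ)) *
    Complex.exp (Complex.I * (Real.pi : ℂ) * (j : ℂ) / (2 * (N : ℂ)))

open Filter Topology Complex

/-! Put `z = x / (2π)`, `l = log z`, `β = z ^ 2`. Adding Gauss' limit formulas at `±i w` gives `-2γ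
- 2 log w + 2 ∑ w² / (m (m² + w²))` for the sum of the two values of `ψ - log`
(`digamma_sub_log_symm`). At the `N` root points the numbers `w²` are, for odd `N`, the `N`-th roots
of a single number, so partial fractions merge their series into one with denominators `m ^ (2N) +
n² / β` (`sum_rationalTerm_rootArg`).

Moving the `𝓕_{1,N}` terms to the left leaves two double series over `m, n`, with summands `1 / (m
n)` times `n² / (n² + m ^ (2N) β)` and `m ^ (2N) β / (n² + m ^ (2N) β)`. These add up to `1 / (m n)`
(`rationalTerm_add_rationalTerm`). With the cutoffs `n ≤ Y ^ N`, `m ≤ Y`, the rectangle contributes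
a product of harmonic numbers. The tails outside it are asymptotically Riemann sums of `log (1 + β u
^ p) / u` (`tendsto_sum_tsum_rationalTerm`), and the inversion formula of the dilogarithm evaluates
their combination as `π² / 12 + l²` (`logIntegral_add_logIntegral_inv`). The sums of `log n / n`
supply `γ₁` (`tendsto_stieltjesOne`), and the powers of `log Y` cancel (`tendsto_rearrangement`). -/

/-! ### Positive combinations in the slit plane. -/

theorem ofReal_add_ofReal_mul_mem_slitPlane {w : ℂ} (hw : w ∈ slitPlane) {s t : ℝ}
    (hs : 0 ≤ s) (ht : 0 ≤ t) (hst : 0 < s + t) : (s : ℂ) + t * w ∈ slitPlane := by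
  rw [mem_slitPlane_iff] at hw ⊢
  simp only [add_re, ofReal_re, mul_re, ofReal_im, zero_mul, sub_zero, add_im, mul_im, add_zero,
    zero_add]
  rcases ht.eq_or_lt with rfl | ht
  · left; simpa using hst
  · rcases hw with hw | hw
    · left; positivity
    · right; exact mul_ne_zero ht.ne' hw

theorem add_ofReal_mem_slitPlane {w : ℂ} (hw : w ∈ slitPlane) {s : ℝ} (hs : 0 ≤ s) :
    w + s ∈ slitPlane := by
  have := ofReal_add_ofReal_mul_mem_slitPlane hw hs zero_le_one (by linarith)
  rwa [ofReal_one, one_mul, add_comm] at this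

theorem ofReal_mul_mem_slitPlane {w : ℂ} (hw : w ∈ slitPlane) {t : ℝ} (ht : 0 < t) :
    (t : ℂ) * w ∈ slitPlane := by
  simpa using ofReal_add_ofReal_mul_mem_slitPlane hw le_rfl ht.le (by linarith)

/-- By homogeneity it suffices to take `s + t = 1`: the compact segment from `1` to `w` stays in the
slit plane, hence away from `0`. This `c` makes the later denominator estimates uniform in the
scale. -/
theorem exists_pos_mul_add_le_norm {w : ℂ} (hw : w ∈ slitPlane) :
    ∃ c : ℝ, 0 < c ∧ ∀ s t : ℝ, 0 ≤ s → 0 ≤ t → c * (s + t) ≤ ‖(s : ℂ) + t * w‖ := by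
  obtain ⟨θ, hθ, hmin⟩ := isCompact_Icc.exists_isMinOn (Set.nonempty_Icc.2 (zero_le_one' ℝ))
    (f := fun θ : ℝ => ‖((1 - θ : ℝ) : ℂ) + θ * w‖) (by fun_prop)
  refine ⟨‖((1 - θ : ℝ) : ℂ) + θ * w‖, ?_, fun s t hs ht => ?_⟩
  · exact norm_pos_iff.2 (slitPlane_ne_zero (ofReal_add_ofReal_mul_mem_slitPlane hw
      (by linarith [hθ.2]) hθ.1 (by linarith)))
  · rcases (add_nonneg hs ht).eq_or_lt with h | h
    · rw [← h]; simp
    · have h1 := hmin (a := t / (s + t)) ⟨by positivity, by rw [div_le_one h]; linarith⟩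
      simp only [Set.mem_ofPred_eq] at h1
      have h2 : (s : ℂ) + t * w = ((s + t : ℝ) : ℂ) *
          (((1 - t / (s + t) : ℝ) : ℂ) + ((t / (s + t) : ℝ) : ℂ) * w) := by
        have : ((s + t : ℝ) : ℂ) ≠ 0 := ofReal_ne_zero.2 h.ne'
        push_cast at this ⊢
        field_simp
        ring
      rw [h2, norm_mul, norm_real, Real.norm_of_nonneg h.le, mul_comm]
      gcongr

/-! ### Gauss' limit formula for the digamma function. -/

/-- The logarithm of the `n`-th term of Euler's product for the Gamma function. -/
noncomputable def logGammaSeq (n : ℕ) (s : ℂ) : ℂ :=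
  s * Real.log n + Real.log n.factorial - ∑ j ∈ Finset.range (n + 1), log (s + j)

theorem exp_logGammaSeq {n : ℕ} (hn : n ≠ 0) {s : ℂ} (hs : s ∈ slitPlane) :
    exp (logGammaSeq n s) = GammaSeq s n := by
  have h : ∀ j ∈ Finset.range (n + 1), exp (log (s + j)) = s + j := fun j _ =>
    exp_log (slitPlane_ne_zero (by
      simpa using add_ofReal_mem_slitPlane hs (Nat.cast_nonneg (α := ℝ) j)))
  rw [logGammaSeq, exp_sub, exp_add, exp_sum, Finset.prod_congr rfl h, GammaSeq,
    cpow_def_of_ne_zero (by exact_mod_cast hn), natCast_log, mul_comm, natCast_log,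
    exp_log (by exact_mod_cast n.factorial_ne_zero), mul_comm s]
  ring

theorem hasDerivAt_logGammaSeq (n : ℕ) {s : ℂ} (hs : s ∈ slitPlane) :
    HasDerivAt (logGammaSeq n)
      (Real.log n - ∑ j ∈ Finset.range (n + 1), 1 / (s + j)) s := by
  have h1 : HasDerivAt (fun s : ℂ => ∑ j ∈ Finset.range (n + 1), log (s + j))
      (∑ j ∈ Finset.range (n + 1), 1 / (s + j)) s := by
    refine HasDerivAt.fun_sum fun j _ => ?_
    refine HasDerivAt.clog ((hasDerivAt_id s).add_const _) ?_
    simpa using add_ofReal_mem_slitPlane hs (Nat.cast_nonneg (α := ℝ) j)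
  have h2 := (((hasDerivAt_id s).mul_const (Real.log n : ℂ)).add_const
    (Real.log n.factorial : ℂ)).sub h1
  rw [one_mul] at h2
  exact h2

/-- With `y = 1 / (n + 1)` the difference is `-s log (1 - y) - log (1 + s y)`, whose first-order
terms cancel; `2 R ≤ n` keeps both arguments within `1 / 2` of `1`. -/
theorem norm_logGammaSeq_succ_sub_le {n : ℕ} {s : ℂ} {R : ℝ} (hs : s ∈ slitPlane)
    (hsR : ‖s‖ ≤ R) (hR : 1 ≤ R) (hn : 2 * R ≤ n) :
    ‖logGammaSeq (n + 1) s - logGammaSeq n s‖ ≤ 2 * R ^ 2 / (n + 1 : ℝ) ^ 2 := by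
  have hn0 : (0 : ℝ) < n := by linarith
  set y : ℝ := 1 / (n + 1) with hy
  have hy0 : 0 < y := by positivity
  have hyR : R * y ≤ 1 / 2 := by
    rw [hy, mul_one_div, div_le_iff₀ (by positivity)]; linarith
  have e1 : logGammaSeq (n + 1) s - logGammaSeq n s =
      -s * (log (1 + (-y : ℂ)) - (-y : ℂ)) - (log (1 + s * y) - s * y) := by
    have a1 : log (1 + (-y : ℂ)) = Real.log n - Real.log (n + 1) := by
      have : (1 + (-y : ℂ)) = ((n / (n + 1) : ℝ) : ℂ) := by
        rw [hy]
        have : (n : ℂ) + 1 ≠ 0 := by exact_mod_cast n.succ_ne_zero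
        push_cast; field_simp; ring
      rw [this, ← ofReal_log (by positivity), Real.log_div (by positivity) (by positivity)]
      push_cast; rfl
    have a2 : log (s + ((n + 1 : ℕ) : ℂ)) = Real.log (n + 1) + log (1 + s * y) := by
      have h0 : (n : ℂ) + 1 ≠ 0 := by exact_mod_cast n.succ_ne_zero
      have : s + ((n + 1 : ℕ) : ℂ) = ((n + 1 : ℝ) : ℂ) * (1 + s * y) := by
        rw [hy]
        push_cast; field_simp; ring
      rw [this, log_ofReal_mul (by positivity)]
      intro h
      rw [h, mul_zero] at this
      refine slitPlane_ne_zero (add_ofReal_mem_slitPlane hs (Nat.cast_nonneg (α := ℝ) (n + 1))) ?_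
      simpa using this
    rw [logGammaSeq, logGammaSeq, Finset.sum_range_succ _ (n + 1), a2, a1, Nat.factorial_succ]
    push_cast
    rw [Real.log_mul (by positivity) (by positivity)]
    push_cast
    ring
  have ny : ‖(-y : ℂ)‖ = y := by rw [norm_neg, norm_real, Real.norm_of_nonneg hy0.le]
  have nsy : ‖s * y‖ ≤ R * y := by
    rw [norm_mul, norm_real, Real.norm_of_nonneg hy0.le]; gcongr
  have key : ∀ u : ℂ, ‖u‖ ≤ R * y → ‖log (1 + u) - u‖ ≤ ‖u‖ ^ 2 := by
    intro u hu
    have h1 : ‖u‖ ≤ 1 / 2 := hu.trans hyR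
    refine (norm_log_one_add_sub_self_le (by linarith)).trans ?_
    have : (1 - ‖u‖)⁻¹ ≤ 2 := by
      rw [inv_le_comm₀ (by linarith) (by norm_num)]; linarith
    nlinarith [sq_nonneg ‖u‖]
  have b1 := key (-y : ℂ) (by rw [ny]; nlinarith)
  have b2 := (key _ nsy).trans (pow_le_pow_left₀ (norm_nonneg _) nsy 2)
  rw [ny] at b1
  rw [e1]
  calc _ ≤ ‖-s * (log (1 + (-y : ℂ)) - (-y : ℂ))‖ + ‖log (1 + s * y) - s * y‖ := norm_sub_le _ _
    _ ≤ R * y ^ 2 + (R * y) ^ 2 := by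
        rw [norm_mul, norm_neg]; gcongr
    _ ≤ 2 * R ^ 2 * y ^ 2 := by nlinarith [sq_nonneg y, mul_nonneg (sub_nonneg.2 hR) (sq_nonneg y)]
    _ = _ := by rw [hy]; field_simp

/-- Gauss' limit formula for the digamma function. -/
theorem tendsto_digamma {w : ℂ} (hw : w ∈ slitPlane) :
    Tendsto (fun M : ℕ => (Real.log M : ℂ) - ∑ j ∈ Finset.range (M + 1), 1 / (w + j)) atTop
      (𝓝 (digamma w)) := by
  obtain ⟨r, hr, hball⟩ := Metric.isOpen_iff.1 isOpen_slitPlane w hw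
  set R : ℝ := ‖w‖ + r + 1
  have hR : 1 ≤ R := by have := norm_nonneg w; linarith
  have hbR : ∀ s ∈ Metric.ball w r, ‖s‖ ≤ R := fun s hs => by
    have h1 : ‖s - w‖ < r := by simpa [dist_eq_norm] using hs
    have h2 := norm_le_norm_add_norm_sub' s w
    linarith
  obtain ⟨n₀, hn₀⟩ := exists_nat_ge (2 * R)
  let d : ℕ → ℂ → ℂ := fun k s => logGammaSeq (n₀ + k + 1) s - logGammaSeq (n₀ + k) s
  let u : ℕ → ℝ := fun k => 2 * R ^ 2 / ((n₀ + k : ℕ) + 1 : ℝ) ^ 2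
  have hu : Summable u := by
    have h1 : Summable fun n : ℕ => 2 * R ^ 2 / (n : ℝ) ^ 2 :=
      (Real.summable_nat_pow_inv.2 one_lt_two).mul_left (2 * R ^ 2)
    refine ((summable_nat_add_iff (n₀ + 1)).2 h1).congr fun k => ?_
    simp only [u]
    push_cast
    ring
  have hd : ∀ k, DifferentiableOn ℂ (d k) (Metric.ball w r) := fun k s hs =>
    ((hasDerivAt_logGammaSeq _ (hball hs)).sub
      (hasDerivAt_logGammaSeq _ (hball hs))).differentiableAt.differentiableWithinAt
  have hdu : ∀ (k : ℕ) (s : ℂ), s ∈ Metric.ball w r → ‖d k s‖ ≤ u k := fun k s hs =>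
    norm_logGammaSeq_succ_sub_le (hball hs) (hbR s hs) hR (by
      push_cast; have := Nat.cast_nonneg (α := ℝ) k; linarith)
  have hwb : w ∈ Metric.ball w r := Metric.mem_ball_self hr
  -- The increments are dominated uniformly on the ball, so their series may be differentiated term
  -- by term.
  have hsumd := hasSum_deriv_of_summable_norm hu hd Metric.isOpen_ball hdu hwb
  have hDiff := differentiableOn_tsum_of_summable_norm hu hd Metric.isOpen_ball hdu
  set D : ℂ → ℂ := fun s => ∑' k, d k s
  have tele : ∀ s K, ∑ k ∈ Finset.range K, d k s = logGammaSeq (n₀ + K) s - logGammaSeq n₀ s :=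
    fun s K => Finset.sum_range_sub (fun k => logGammaSeq (n₀ + k) s) K
  have hlim : ∀ s ∈ Metric.ball w r,
      Tendsto (fun K => logGammaSeq (n₀ + K) s) atTop (𝓝 (logGammaSeq n₀ s + D s)) := by
    intro s hs
    have h1 : HasSum (fun k => d k s) (D s) :=
      (Summable.of_norm_bounded hu fun k => hdu k s hs).hasSum
    have h2 := h1.tendsto_sum_nat.const_add (logGammaSeq n₀ s)
    simpa [tele] using h2
  -- Only the exponential of the limit is compared with `Γ`; the logarithmic derivative does not
  -- depend on the branch.
  have hGamma : ∀ s ∈ Metric.ball w r, Gamma s = exp (logGammaSeq n₀ s + D s) := by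
    intro s hs
    have h1 := (continuous_exp.tendsto _).comp (hlim s hs)
    have h2 := (tendsto_add_atTop_iff_nat n₀).2 (GammaSeq_tendsto_Gamma s)
    refine tendsto_nhds_unique (h2.congr' ?_) h1
    filter_upwards [eventually_gt_atTop 0] with K hK
    rw [Function.comp_apply, exp_logGammaSeq (by omega) (hball hs), add_comm]
  have hDw : HasDerivAt D (deriv D w) w :=
    (hDiff.differentiableAt (Metric.isOpen_ball.mem_nhds hwb)).hasDerivAt
  have hG : HasDerivAt Gamma _ w :=
    ((hasDerivAt_logGammaSeq n₀ hw).add hDw).cexp.congr_of_eventuallyEq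
      (Filter.eventually_of_mem (Metric.isOpen_ball.mem_nhds hwb) hGamma)
  have hdig : digamma w = (Real.log n₀ - ∑ j ∈ Finset.range (n₀ + 1), 1 / (w + j)) + deriv D w := by
    rw [digamma_def, logDeriv_apply, hG.deriv, hGamma w hwb]
    exact mul_div_cancel_left₀ _ (exp_ne_zero _)
  rw [hdig, ← tendsto_add_atTop_iff_nat n₀]
  have h3 := hsumd.tendsto_sum_nat.const_add
    ((Real.log n₀ : ℂ) - ∑ j ∈ Finset.range (n₀ + 1), 1 / (w + j))
  refine h3.congr fun K => ?_
  have h4 : ∀ k, deriv (d k) w = (Real.log (n₀ + k + 1 : ℕ) -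
      ∑ j ∈ Finset.range (n₀ + k + 1 + 1), 1 / (w + j)) -
      (Real.log (n₀ + k : ℕ) - ∑ j ∈ Finset.range (n₀ + k + 1), 1 / (w + j)) := fun k =>
    ((hasDerivAt_logGammaSeq _ hw).sub (hasDerivAt_logGammaSeq _ hw)).deriv
  have h5 := Finset.sum_range_sub (fun k => ((Real.log (n₀ + k : ℕ) : ℂ) -
      ∑ j ∈ Finset.range (n₀ + k + 1), 1 / (w + j))) K
  simp only [← add_assoc] at h5
  rw [Finset.sum_congr rfl fun k _ => h4 k, h5, add_comm K]
  simp

/-! ### Decay of `ψ - log` and absolute convergence. -/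

/-- Mean value inequality for `log (y + t w) - y / (s + t w)` on `[s, s + 1]`, whose derivative is a
difference of two nearby reciprocals. -/
theorem norm_log_add_one_sub_log_sub_le {w : ℂ} {c s t : ℝ} (hw : w ∈ slitPlane) (hc : 0 < c)
    (hcw : ∀ s t : ℝ, 0 ≤ s → 0 ≤ t → c * (s + t) ≤ ‖(s : ℂ) + t * w‖) (hs : 0 ≤ s) (ht : 0 < t) :
    ‖log ((s + 1 : ℝ) + t * w) - log (s + t * w) - 1 / (s + t * w)‖ ≤
      1 / (c ^ 2 * (s + t) ^ 2) := by
  have hmem : ∀ y : ℝ, 0 ≤ y → ((y : ℂ) + t * w) ∈ slitPlane := fun y hy =>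
    ofReal_add_ofReal_mul_mem_slitPlane hw hy ht.le (by linarith)
  have hder : ∀ y ∈ Set.Icc s (s + 1), HasDerivWithinAt
      (fun y : ℝ => log ((y : ℂ) + t * w) - (y : ℂ) * (1 / (s + t * w)))
      (1 / (y + t * w) - 1 / (s + t * w)) (Set.Icc s (s + 1)) y := by
    intro y hy
    have h1 : HasDerivAt (fun y : ℝ => log ((y : ℂ) + t * w)) (1 / (y + t * w)) y :=
      (ofRealCLM.hasDerivAt.add_const (t * w : ℂ)).clog_real (hmem y (hs.trans hy.1))
    have h2 : HasDerivAt (fun y : ℝ => (y : ℂ) * (1 / (s + t * w))) (1 / (s + t * w)) y := by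
      simpa using! (ofRealCLM.hasDerivAt (x := y)).mul_const (1 / ((s : ℂ) + t * w))
    exact (h1.sub h2).hasDerivWithinAt
  have hb : ∀ y ∈ Set.Ico s (s + 1), ‖1 / ((y : ℂ) + t * w) - 1 / (s + t * w)‖ ≤
      1 / (c ^ 2 * (s + t) ^ 2) := by
    intro y hy
    have n1 := slitPlane_ne_zero (hmem y (hs.trans hy.1))
    have n2 := slitPlane_ne_zero (hmem s hs)
    have e : 1 / ((y : ℂ) + t * w) - 1 / (s + t * w) =
        ((s - y : ℝ) : ℂ) / ((y + t * w) * (s + t * w)) := by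
      push_cast; field_simp; ring
    rw [e, norm_div, norm_mul, norm_real]
    have b1 := hcw y t (hs.trans hy.1) ht.le
    have b2 := hcw s t hs ht.le
    have b3 : c * (s + t) ≤ c * (y + t) := by gcongr; exact hy.1
    have b4 : ‖s - y‖ ≤ 1 := by
      rw [Real.norm_eq_abs, abs_le]; constructor <;> linarith [hy.1, hy.2]
    refine div_le_div₀ zero_le_one b4 (by positivity) ?_
    calc c ^ 2 * (s + t) ^ 2 = (c * (s + t)) * (c * (s + t)) := by ring
      _ ≤ _ := mul_le_mul (b3.trans b1) b2 (by positivity) (norm_nonneg _)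
  have := norm_image_sub_le_of_norm_deriv_le_segment' hder hb (s + 1) ⟨by linarith, le_rfl⟩
  refine le_trans (le_of_eq ?_) (this.trans (le_of_eq (by ring)))
  congr 1
  push_cast
  ring

theorem sum_inv_add_sq_le {t : ℝ} (ht : 1 ≤ t) (M : ℕ) :
    ∑ n ∈ Finset.range M, 1 / ((n : ℝ) + t) ^ 2 ≤ 2 / t := by
  have h : ∀ n : ℕ, 1 / ((n : ℝ) + t) ^ 2 ≤ 2 / (n + t) - 2 / ((n + 1 : ℕ) + t) := by
    intro n
    have h0 : (0 : ℝ) ≤ n := n.cast_nonneg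
    push_cast
    rw [div_sub_div _ _ (by positivity) (by positivity), div_le_div_iff₀ (by positivity)
      (by positivity)]
    nlinarith [mul_nonneg h0 h0, mul_nonneg h0 (by linarith : (0 : ℝ) ≤ t)]
  calc _ ≤ ∑ n ∈ Finset.range M, (2 / ((n : ℝ) + t) - 2 / ((n + 1 : ℕ) + t)) :=
        Finset.sum_le_sum fun n _ => h n
    _ = 2 / t - 2 / (M + t) := by
        rw [Finset.sum_range_sub' (fun n : ℕ => 2 / ((n : ℝ) + t))]; simp
    _ ≤ 2 / t := by
        have : 0 ≤ 2 / ((M : ℝ) + t) := by positivity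
        linarith

theorem tendsto_log_natCast_sub_log_add {w : ℂ} (hw : w ∈ slitPlane) :
    Tendsto (fun M : ℕ => (Real.log M : ℂ) - log ((M : ℝ) + w)) atTop (𝓝 0) := by
  have h1 : Tendsto (fun M : ℕ => 1 + w * ((M : ℂ))⁻¹) atTop (𝓝 1) := by
    simpa using (tendsto_inv_atTop_nhds_zero_nat (𝕜 := ℂ)).const_mul w |>.const_add 1
  have h2 := (h1.clog one_mem_slitPlane).neg
  rw [log_one, neg_zero] at h2
  refine h2.congr' ?_
  filter_upwards [eventually_gt_atTop 0] with M hM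
  have hM' : (0 : ℝ) < M := by exact_mod_cast hM
  have hM0 : (M : ℂ) ≠ 0 := by exact_mod_cast hM.ne'
  have e : ((M : ℝ) : ℂ) + w = ((M : ℝ) : ℂ) * (1 + w * (M : ℂ)⁻¹) := by
    push_cast; field_simp
  rw [e, log_ofReal_mul hM']
  · ring
  · intro h
    rw [h, mul_zero, add_comm] at e
    exact slitPlane_ne_zero (add_ofReal_mem_slitPlane hw hM'.le) e

/-- Telescoping the logarithm against Gauss' sum writes `ψ - log` as a limit of sums of one-step
errors of size `1 / (j + t) ^ 2`, which total `O(1 / t)`. -/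
theorem exists_norm_digamma_sub_log_le {w : ℂ} (hw : w ∈ slitPlane) :
    ∃ C : ℝ, 0 ≤ C ∧ ∀ t : ℝ, 1 ≤ t → ‖digamma (t * w) - log (t * w)‖ ≤ C / t := by
  obtain ⟨c, hc, hcw⟩ := exists_pos_mul_add_le_norm hw
  refine ⟨2 / c ^ 2, by positivity, fun t ht => ?_⟩
  have ht0 : 0 < t := by linarith
  have htw := ofReal_mul_mem_slitPlane hw ht0
  have hsum : ∀ M : ℕ, log ((M : ℝ) + t * w) - log (t * w) -
      ∑ j ∈ Finset.range M, 1 / (t * w + j) = ∑ j ∈ Finset.range M,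
        (log (((j : ℝ) + 1 : ℝ) + t * w) - log ((j : ℝ) + t * w) - 1 / ((j : ℝ) + t * w)) := by
    intro M
    rw [Finset.sum_sub_distrib]
    have := Finset.sum_range_sub (fun j : ℕ => log (((j : ℝ) : ℂ) + t * w)) M
    push_cast at this ⊢
    rw [this]
    simp [add_comm]
  have hbound : ∀ M : ℕ, ‖log ((M : ℝ) + t * w) - log (t * w) -
      ∑ j ∈ Finset.range M, 1 / (t * w + j)‖ ≤ 2 / c ^ 2 / t := by
    intro M
    rw [hsum]
    refine (norm_sum_le _ _).trans ?_
    calc _ ≤ ∑ j ∈ Finset.range M, 1 / c ^ 2 * (1 / ((j : ℝ) + t) ^ 2) := by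
          refine Finset.sum_le_sum fun j _ => ?_
          refine (norm_log_add_one_sub_log_sub_le hw hc hcw j.cast_nonneg ht0).trans
            (le_of_eq ?_)
          field_simp
      _ ≤ 1 / c ^ 2 * (2 / t) := by
          rw [← Finset.mul_sum]
          gcongr
          exact sum_inv_add_sq_le ht M
      _ = _ := by field_simp
  have hlim2 : Tendsto (fun M : ℕ => log ((M : ℝ) + t * w) - log (t * w) -
      ∑ j ∈ Finset.range M, 1 / (t * w + j)) atTop (𝓝 (digamma (t * w) - log (t * w))) := by
    -- Gauss' sum has `M + 1` terms, one more than the telescoping sum; the extra term vanishes in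
    -- the limit.
    have hz : Tendsto (fun M : ℕ => 1 / (t * w + (M : ℂ))) atTop (𝓝 0) := by
      simp_rw [one_div]
      exact tendsto_inv₀_cobounded.comp
        ((tendsto_const_add_cobounded _).comp
          tendsto_natCast_atTop_cobounded)
    have h5 := (((tendsto_digamma htw).sub (tendsto_log_natCast_sub_log_add htw)).sub_const
      (log (t * w))).add hz
    rw [sub_zero, add_zero] at h5
    refine h5.congr fun M => ?_
    rw [Finset.sum_range_succ]
    ring
  exact le_of_tendsto hlim2.norm (Eventually.of_forall hbound)

theorem summable_herglotzTerm {N : ℝ} (hN : 0 < N) {w : ℂ} (hw : w ∈ slitPlane) :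
    Summable fun n : ℕ => herglotzTerm 1 N w (n + 1) := by
  obtain ⟨C, hC, h⟩ := exists_norm_digamma_sub_log_le hw
  have hs : Summable fun n : ℕ => C / ((n + 1 : ℕ) : ℝ) ^ (1 + N) := by
    simpa only [div_eq_mul_inv] using (summable_nat_add_iff (f := fun n : ℕ =>
      C * ((n : ℝ) ^ (1 + N))⁻¹) 1).2
        ((Real.summable_nat_rpow_inv.2 (by linarith : 1 < 1 + N)).mul_left C)
  refine Summable.of_norm_bounded hs fun n => ?_
  have hn : (1 : ℝ) ≤ ((n + 1 : ℕ) : ℝ) := by push_cast; linarith [n.cast_nonneg (α := ℝ)]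
  have hn0 : (0 : ℝ) < ((n + 1 : ℕ) : ℝ) := by linarith
  have hb := h _ (Real.one_le_rpow hn hN.le)
  rw [herglotzTerm]
  generalize ((n + 1 : ℕ) : ℝ) = y at hn0 hb ⊢
  have e : C / y ^ (1 + N) = C / y ^ N / y ^ (1 : ℝ) := by
    rw [Real.rpow_add hn0]; field_simp
  rw [e, norm_div, norm_real, Real.norm_of_nonneg (Real.rpow_nonneg hn0.le 1)]
  gcongr

/-! ### The even part of `ψ - log` and its sum over the root points. -/

/-- The summand `b / (m (m ^ p + b))`. -/
noncomputable def rationalTerm (p : ℕ) (b : ℂ) (m : ℕ) : ℂ :=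
  b / ((m : ℂ) * ((m : ℂ) ^ p + b))

theorem add_natCast_mem_slitPlane {w : ℂ} (hw : w ∈ slitPlane) (n : ℕ) : w + n ∈ slitPlane := by
  simpa only [ofReal_natCast] using add_ofReal_mem_slitPlane hw (Nat.cast_nonneg (α := ℝ) n)

theorem sq_mem_slitPlane {w : ℂ} (hw : 0 < w.re) : w ^ 2 ∈ slitPlane := by
  rw [mem_slitPlane_iff, sq, mul_re, mul_im]
  by_cases h : w.im = 0
  · left; rw [h]; nlinarith
  · right
    intro h'
    have : w.re * w.im = 0 := by linarith
    rcases mul_eq_zero.1 this with h1 | h1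
    · exact hw.ne' h1
    · exact h h1

theorem I_mul_mem_slitPlane {w : ℂ} (hw : 0 < w.re) : I * w ∈ slitPlane := by
  rw [mem_slitPlane_iff]; right; simpa using hw.ne'

theorem neg_I_mul_mem_slitPlane {w : ℂ} (hw : 0 < w.re) : -I * w ∈ slitPlane := by
  rw [mem_slitPlane_iff]; right; simpa using hw.ne'

/-- For `Re w > 0` the arguments `arg w ± π / 2` stay inside `(-π, π)`, so the two corrections `±iπ
/ 2` cancel exactly. -/
theorem log_I_mul_add_log_neg_I_mul {w : ℂ} (hw : 0 < w.re) :
    log (I * w) + log (-I * w) = 2 * log w := by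
  have h0 : w ≠ 0 := by rintro rfl; simp at hw
  have h1 := abs_lt.1 (abs_arg_lt_pi_div_two_iff.2 (Or.inl hw))
  rw [log_mul I_ne_zero h0, log_mul (neg_ne_zero.2 I_ne_zero) h0, log_I, log_neg_I]
  · ring
  · rw [arg_neg_I]; constructor <;> linarith
  · rw [arg_I]; constructor <;> linarith

theorem norm_rationalTerm_le {β : ℂ} {c t : ℝ} (hc : 0 < c)
    (hcβ : ∀ s t : ℝ, 0 ≤ s → 0 ≤ t → c * (s + t) ≤ ‖(s : ℂ) + t * β‖) (ht : 0 ≤ t)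
    (p : ℕ) {m : ℕ} (hm : m ≠ 0) :
    ‖rationalTerm p (t * β) m‖ ≤ t * ‖β‖ / c * (1 / (m : ℝ) ^ (p + 1)) := by
  have hm' : (0 : ℝ) < m := by positivity
  have h1 := hcβ ((m : ℝ) ^ p) t (by positivity) ht
  have h2 : c * (m : ℝ) ^ p ≤ c * ((m : ℝ) ^ p + t) := by gcongr; linarith
  rw [rationalTerm, norm_div, norm_mul, norm_mul, norm_real, Real.norm_of_nonneg ht, norm_natCast]
  push_cast at h1
  calc _ ≤ t * ‖β‖ / (m * (c * (m : ℝ) ^ p)) := by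
        gcongr; exact h2.trans h1
    _ = _ := by rw [pow_succ]; field_simp

theorem summable_rationalTerm {b : ℂ} (hb : b ∈ slitPlane) {p : ℕ} (hp : p ≠ 0) :
    Summable fun m : ℕ => rationalTerm p b (m + 1) := by
  obtain ⟨c, hc, hcb⟩ := exists_pos_mul_add_le_norm hb
  have hs : Summable fun m : ℕ => 1 * ‖b‖ / c * (1 / ((m + 1 : ℕ) : ℝ) ^ (p + 1)) :=
    ((summable_nat_add_iff 1).2 (Real.summable_one_div_nat_pow.2 (by omega))).mul_left _
  refine Summable.of_norm_bounded hs fun m => ?_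
  simpa using norm_rationalTerm_le hc hcb zero_le_one p m.succ_ne_zero

theorem tendsto_sum_one_div_sub_log :
    Tendsto (fun M : ℕ => ∑ j ∈ Finset.range M, 1 / ((j + 1 : ℕ) : ℂ) - Real.log M) atTop
      (𝓝 Real.eulerMascheroniConstant) := by
  refine ((continuous_ofReal.tendsto _).comp Real.tendsto_harmonic_sub_log).congr fun M => ?_
  simp [harmonic]

/-- The even part of `ψ - log` on the imaginary axis as a series of rational functions. -/
theorem digamma_sub_log_symm {w : ℂ} (hw : 0 < w.re) :
    (digamma (I * w) - log (I * w)) + (digamma (-I * w) - log (-I * w)) =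
      -2 * Real.eulerMascheroniConstant - 2 * log w +
        2 * ∑' m : ℕ, rationalTerm 2 (w ^ 2) (m + 1) := by
  have h1 := (tendsto_digamma (I_mul_mem_slitPlane hw)).add
    (tendsto_digamma (neg_I_mul_mem_slitPlane hw))
  have h2 := ((summable_rationalTerm (sq_mem_slitPlane hw)
    two_ne_zero).hasSum.tendsto_sum_nat.const_mul 2).sub (tendsto_sum_one_div_sub_log.const_mul 2)
  have h3 := tendsto_nhds_unique (h1.congr fun M => ?_) h2
  · linear_combination h3 - log_I_mul_add_log_neg_I_mul hw
  · have e : ∀ j : ℕ, 1 / (I * w + ((j + 1 : ℕ) : ℂ)) + 1 / (-I * w + ((j + 1 : ℕ) : ℂ)) =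
        2 * (1 / ((j + 1 : ℕ) : ℂ)) - 2 * rationalTerm 2 (w ^ 2) (j + 1) := by
      intro j
      have n0 : ((j + 1 : ℕ) : ℂ) ≠ 0 := by exact_mod_cast j.succ_ne_zero
      have n1 : I * w + ((j + 1 : ℕ) : ℂ) ≠ 0 := slitPlane_ne_zero
        (add_natCast_mem_slitPlane (I_mul_mem_slitPlane hw) (j + 1))
      have n2 : -I * w + ((j + 1 : ℕ) : ℂ) ≠ 0 := slitPlane_ne_zero
        (add_natCast_mem_slitPlane (neg_I_mul_mem_slitPlane hw) (j + 1))
      rw [rationalTerm]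
      generalize ((j + 1 : ℕ) : ℂ) = y at *
      have e0 : -I * w + y = y - I * w := by ring
      have e1 : y ^ 2 + w ^ 2 = (I * w + y) * (y - I * w) := by
        linear_combination w ^ 2 * I_sq
      rw [e0] at n2 ⊢
      rw [e1]
      field_simp
      linear_combination 2 * w ^ 2 * I_sq
    -- The terms with index `0` are opposite, so the sums effectively start at `1`.
    have e0 : 1 / (I * w + ((0 : ℕ) : ℂ)) + 1 / (-I * w + ((0 : ℕ) : ℂ)) = 0 := by
      simp
    have e2 : ∑ j ∈ Finset.range (M + 1), 1 / (I * w + j) +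
        ∑ j ∈ Finset.range (M + 1), 1 / (-I * w + j) =
        2 * ∑ j ∈ Finset.range M, 1 / ((j + 1 : ℕ) : ℂ) -
          2 * ∑ j ∈ Finset.range M, rationalTerm 2 (w ^ 2) (j + 1) := by
      rw [← Finset.sum_add_distrib, Finset.sum_range_succ', e0, add_zero,
        Finset.sum_congr rfl fun j _ => e j, Finset.sum_sub_distrib, Finset.mul_sum,
        Finset.mul_sum]
    linear_combination -e2

/-- For odd `N` every `-c ζ ^ m` has `N`-th power `-c ^ N`, so a geometric sum puts each fraction
over the common denominator `X ^ N + c ^ N`. Summation over `m` kills every power of `X` except the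
zeroth. -/
theorem sum_div_add_primitiveRoot {N : ℕ} (hN : Odd N) {ζ : ℂ} (hζ : IsPrimitiveRoot ζ N)
    (c : ℂ) {X : ℂ} (hX : X ^ N + c ^ N ≠ 0) :
    ∑ m ∈ Finset.range N, c * ζ ^ m / (X + c * ζ ^ m) = N * c ^ N / (X ^ N + c ^ N) := by
  have hpow : ∀ m, (-(c * ζ ^ m)) ^ N = -c ^ N := fun m => by
    rw [hN.neg_pow, mul_pow, ← pow_mul, mul_comm m, pow_mul, hζ.pow_eq_one, one_pow, mul_one]
  have hterm : ∀ m, c * ζ ^ m / (X + c * ζ ^ m) =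
      (∑ k ∈ Finset.range N, X ^ k * (-(-c) ^ (N - k) * (ζ ^ (N - k)) ^ m)) / (X ^ N + c ^ N) := by
    intro m
    have h1 := (Commute.all X (-(c * ζ ^ m))).geom_sum₂_mul N
    rw [hpow, sub_neg_eq_add, sub_neg_eq_add] at h1
    have h2 : X + c * ζ ^ m ≠ 0 := fun h => hX (by rw [← h1, h, mul_zero])
    rw [div_eq_div_iff h2 hX, ← h1, ← mul_assoc, Finset.mul_sum]
    congr 1
    refine Finset.sum_congr rfl fun k hk => ?_
    have hk' : N - k = (N - 1 - k) + 1 := by have := Finset.mem_range.1 hk; omega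
    rw [hk', neg_mul_eq_neg_mul, mul_pow, ← pow_mul, ← pow_mul, pow_succ (-c)]
    ring
  rw [Finset.sum_congr rfl fun m _ => hterm m, ← Finset.sum_div]
  congr 1
  rw [Finset.sum_comm]
  have hz : ∀ k ∈ Finset.range N, k ≠ 0 →
      ∑ m ∈ Finset.range N, X ^ k * (-(-c) ^ (N - k) * (ζ ^ (N - k)) ^ m) = 0 := by
    intro k hk hk0
    have hkN := Finset.mem_range.1 hk
    have h1 : ζ ^ (N - k) ≠ 1 := hζ.pow_ne_one_of_pos_of_lt (by omega) (by omega)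
    have h2 : ∑ m ∈ Finset.range N, (ζ ^ (N - k)) ^ m = 0 := by
      rw [geom_sum_eq h1, ← pow_mul, mul_comm, pow_mul, hζ.pow_eq_one, one_pow, sub_self, zero_div]
    simp_rw [← mul_assoc]
    rw [← Finset.mul_sum, h2, mul_zero]
  rw [Finset.sum_eq_single 0 (fun k hk hk0 => hz k hk hk0)
    (fun h => absurd (Finset.mem_range.2 hN.pos) h)]
  simp [hζ.pow_eq_one, hN.neg_pow]

/-- The arguments `exp ((l + i π j / 2) / N)` with `j = 2 m - (N - 1)`. -/
noncomputable def rootArg (N : ℕ) (l : ℂ) (m : ℕ) : ℂ :=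
  (l + I * Real.pi * ((2 * (m : ℤ) - ((N : ℤ) - 1) : ℤ) : ℂ) / 2) / N

/-- Since `|j| ≤ N - 1`, the numerator has imaginary part below `π / 2 + (N - 1) π / 2 = N π / 2`.
Hence the root points lie in the right half-plane and `log` inverts `exp` there. -/
theorem abs_im_rootArg_lt {N : ℕ} {l : ℂ} (hl : |l.im| < Real.pi / 2) {m : ℕ} (hm : m < N) :
    |(rootArg N l m).im| < Real.pi / 2 := by
  have hN : (0 : ℝ) < N := by exact_mod_cast (by omega : 0 < N)
  have e : (rootArg N l m).im = (l.im + Real.pi * (2 * m - (N - 1)) / 2) / N := by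
    have : rootArg N l m = (l + ((Real.pi * (2 * m - (N - 1)) / 2 : ℝ) : ℂ) * I) / ((N : ℝ) : ℂ) := by
      rw [rootArg]; push_cast; ring
    rw [this, div_ofReal_im, add_im, im_ofReal_mul, I_im, mul_one]
  have hm1 : (m : ℝ) + 1 ≤ N := by exact_mod_cast hm
  have hm0 : (0 : ℝ) ≤ m := m.cast_nonneg
  rw [e, abs_div, Nat.abs_cast, div_lt_iff₀ hN]
  rw [abs_lt] at hl ⊢
  have hpi := Real.pi_pos
  constructor <;> nlinarith

theorem exp_rootArg_re_pos {N : ℕ} {l : ℂ} (hl : |l.im| < Real.pi / 2) {m : ℕ} (hm : m < N) :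
    0 < (exp (rootArg N l m)).re := by
  rw [exp_re]
  exact mul_pos (Real.exp_pos _) (Real.cos_pos_of_mem_Ioo (abs_lt.1 (abs_im_rootArg_lt hl hm)))

theorem log_exp_rootArg {N : ℕ} {l : ℂ} (hl : |l.im| < Real.pi / 2) {m : ℕ} (hm : m < N) :
    log (exp (rootArg N l m)) = rootArg N l m := by
  have := abs_lt.1 (abs_im_rootArg_lt hl hm)
  have hpi := Real.pi_pos
  exact log_exp (by linarith) (by linarith)

theorem sum_rootArg {N : ℕ} (hN : N ≠ 0) (l : ℂ) : ∑ m ∈ Finset.range N, rootArg N l m = l := by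
  have h : ∑ m ∈ Finset.range N, ((2 * (m : ℤ) - ((N : ℤ) - 1) : ℤ) : ℂ) = 0 := by
    have h1 := Finset.sum_range_id_mul_two N
    have h2 : ((∑ m ∈ Finset.range N, m : ℕ) : ℂ) * 2 = N * (N - 1) := by
      rw [← Nat.cast_two, ← Nat.cast_mul, h1, Nat.cast_mul, Nat.cast_pred (by omega)]
    push_cast at h2 ⊢
    rw [Finset.sum_sub_distrib, ← Finset.mul_sum, Finset.sum_const, Finset.card_range, nsmul_eq_mul]
    linear_combination h2
  have hN' : (N : ℂ) ≠ 0 := by exact_mod_cast hN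
  simp only [rootArg]
  rw [← Finset.sum_div, Finset.sum_add_distrib, ← Finset.sum_div, ← Finset.mul_sum, h]
  simp only [Finset.sum_const, Finset.card_range, nsmul_eq_mul]
  field_simp
  simp

theorem sum_rationalTerm_rootArg {N : ℕ} (hN : Odd N) {l : ℂ} (hl : |l.im| < Real.pi / 2)
    {k : ℕ} (hk : k ≠ 0) :
    ∑ m ∈ Finset.range N, rationalTerm 2 (exp (rootArg N l m) ^ 2) k =
      N * rationalTerm (2 * N) (exp (2 * l)) k := by
  have hN0 : N ≠ 0 := hN.pos.ne'
  have hN' : (N : ℂ) ≠ 0 := by exact_mod_cast hN0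
  obtain ⟨r, hr⟩ := hN
  set ζ : ℂ := exp (2 * Real.pi * I / N)
  have hζ : IsPrimitiveRoot ζ N := isPrimitiveRoot_exp N hN0
  set c : ℂ := exp (rootArg N l 0) ^ 2
  have hc : ∀ m : ℕ, exp (rootArg N l m) ^ 2 = c * ζ ^ m := by
    intro m
    simp only [c, ζ, ← exp_nat_mul, ← exp_add]
    congr 1
    rw [rootArg, rootArg]
    push_cast
    field_simp
    ring
  -- The exponent is `2 l - iπ (N - 1)`, and with `N = 2 r + 1` the excess is `-r` full periods;
  -- oddness is essential.
  have hcN : c ^ N = exp (2 * l) := by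
    simp only [c, ← exp_nat_mul]
    rw [exp_eq_exp_iff_exists_int]
    refine ⟨-r, ?_⟩
    have h1 : (N : ℂ) = 2 * r + 1 := by exact_mod_cast hr
    rw [rootArg]
    push_cast
    field_simp
    rw [h1]
    ring
  have hre : 0 < (exp l).re := by
    rw [exp_re]
    exact mul_pos (Real.exp_pos _) (Real.cos_pos_of_mem_Ioo (abs_lt.1 hl))
  have hX : ((k : ℂ) ^ 2) ^ N + c ^ N ≠ 0 := by
    rw [hcN, two_mul, exp_add, ← sq]
    have := ofReal_add_ofReal_mul_mem_slitPlane (sq_mem_slitPlane hre)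
      (s := ((k : ℝ) ^ 2) ^ N) (by positivity) zero_le_one (by positivity)
    simpa using slitPlane_ne_zero this
  have hk0 : (k : ℂ) ≠ 0 := by exact_mod_cast hk
  have h := sum_div_add_primitiveRoot ⟨r, hr⟩ hζ c hX
  rw [hcN, ← pow_mul] at h
  simp only [rationalTerm, hc]
  calc _ = ∑ m ∈ Finset.range N, (1 / (k : ℂ)) * (c * ζ ^ m / ((k : ℂ) ^ 2 + c * ζ ^ m)) := by
        refine Finset.sum_congr rfl fun m _ => ?_
        rw [div_mul_div_comm, one_mul]
    _ = _ := by
        rw [← Finset.mul_sum, h, div_mul_div_comm, one_mul, mul_div_assoc]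

/-- The sum of `digamma_sub_log_symm` over the points `exp (rootArg N l m)`. -/
theorem sum_digamma_sub_log_rootArg {N : ℕ} (hN : Odd N) {l : ℂ} (hl : |l.im| < Real.pi / 2) :
    ∑ m ∈ Finset.range N,
      ((digamma (I * exp (rootArg N l m)) - log (I * exp (rootArg N l m))) +
        (digamma (-I * exp (rootArg N l m)) - log (-I * exp (rootArg N l m)))) =
      -2 * N * Real.eulerMascheroniConstant - 2 * l +
        2 * N * ∑' k : ℕ, rationalTerm (2 * N) (exp (2 * l)) (k + 1) := by
  have h1 : ∀ m ∈ Finset.range N,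
      (digamma (I * exp (rootArg N l m)) - log (I * exp (rootArg N l m))) +
        (digamma (-I * exp (rootArg N l m)) - log (-I * exp (rootArg N l m))) =
      -2 * Real.eulerMascheroniConstant - 2 * rootArg N l m +
        2 * ∑' k : ℕ, rationalTerm 2 (exp (rootArg N l m) ^ 2) (k + 1) := fun m hm => by
    rw [digamma_sub_log_symm (exp_rootArg_re_pos hl (Finset.mem_range.1 hm)),
      log_exp_rootArg hl (Finset.mem_range.1 hm)]
  have h2 : ∑ m ∈ Finset.range N, ∑' k : ℕ, rationalTerm 2 (exp (rootArg N l m) ^ 2) (k + 1) =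
      N * ∑' k : ℕ, rationalTerm (2 * N) (exp (2 * l)) (k + 1) := by
    rw [← Summable.tsum_finsetSum fun m hm => summable_rationalTerm
      (sq_mem_slitPlane (exp_rootArg_re_pos hl (Finset.mem_range.1 hm))) two_ne_zero, ← tsum_mul_left]
    exact tsum_congr fun k => sum_rationalTerm_rootArg hN hl k.succ_ne_zero
  rw [Finset.sum_congr rfl h1, Finset.sum_add_distrib, Finset.sum_sub_distrib, ← Finset.mul_sum,
    ← Finset.mul_sum, sum_rootArg hN.pos.ne', ← Finset.mul_sum, h2]
  simp only [Finset.sum_const, Finset.card_range, nsmul_eq_mul]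
  ring

/-! ### Tails of the rational series against an integral. -/

/-- `-(1 / p) log (1 + b / u ^ p)` is a primitive of `b / (u (u ^ p + b))`, so this is the error of
a one-step right-endpoint rule. The bound is linear in `t`, as the later summation over the scale
requires. -/
theorem norm_rationalTerm_sub_log_le {β : ℂ} {c t : ℝ} (hβ : β ∈ slitPlane) (hc : 0 < c)
    (hcβ : ∀ s t : ℝ, 0 ≤ s → 0 ≤ t → c * (s + t) ≤ ‖(s : ℂ) + t * β‖) (ht : 0 ≤ t)
    {p : ℕ} (hp : p ≠ 0) {m : ℕ} (hm : m ≠ 0) :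
    ‖rationalTerm p (t * β) (m + 1) - 1 / p * (log (1 + t * β / (m : ℂ) ^ p) -
      log (1 + t * β / ((m + 1 : ℕ) : ℂ) ^ p))‖ ≤
      t * ‖β‖ * ((p + 1) * (1 + ‖β‖)) / c ^ 2 * (1 / (m : ℝ) ^ (p + 2)) := by
  set b : ℂ := t * β with hb
  have hm' : (0 : ℝ) < m := by positivity
  have hp' : (p : ℂ) ≠ 0 := by exact_mod_cast hp
  have hnorm : ∀ u : ℝ, 0 ≤ u → c * (u ^ p + t) ≤ ‖(u : ℂ) ^ p + b‖ := fun u hu => by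
    simpa using hcβ (u ^ p) t (by positivity) ht
  have hne : ∀ u : ℝ, 0 < u → (u : ℂ) ^ p + b ≠ 0 := fun u hu => by
    rw [← norm_pos_iff]
    exact lt_of_lt_of_le (by positivity) (hnorm u hu.le)
  have hslit : ∀ u : ℝ, 0 < u → 1 + b / (u : ℂ) ^ p ∈ slitPlane := fun u hu => by
    have := ofReal_add_ofReal_mul_mem_slitPlane hβ zero_le_one (t := t / u ^ p) (by positivity)
      (by positivity)
    convert! this using 1
    rw [hb]; push_cast; ring
  clear_value b
  set F : ℝ → ℂ := fun u => b / ((u : ℂ) * ((u : ℂ) ^ p + b)) with hF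
  set y : ℝ := (m : ℝ) + 1 with hy
  have hy0 : 0 < y := by positivity
  have hFy : rationalTerm p b (m + 1) = F y := by
    simp [rationalTerm, hF, hy]
  have hder : ∀ u ∈ Set.Icc (m : ℝ) (m + 1), HasDerivWithinAt
      (fun u : ℝ => (u : ℂ) * F y + 1 / p * log (1 + b / (u : ℂ) ^ p))
      (F y - F u) (Set.Icc (m : ℝ) (m + 1)) u := by
    intro u hu
    have hu0 : 0 < u := hm'.trans_le hu.1
    have hu0' : (u : ℂ) ≠ 0 := ofReal_ne_zero.2 hu0.ne'
    have h1 : HasDerivAt (fun u : ℝ => (u : ℂ) * F y) (F y) u := by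
      simpa using! (ofRealCLM.hasDerivAt (x := u)).mul_const (F y)
    have h2 : HasDerivAt (fun u : ℝ => (u : ℂ) ^ p) (p * (u : ℂ) ^ (p - 1)) u := by
      simpa using! (ofRealCLM.hasDerivAt (x := u)).pow p
    have h3 : HasDerivAt (fun u : ℝ => 1 + b / (u : ℂ) ^ p) _ u :=
      ((hasDerivAt_const u b).div h2 (pow_ne_zero _ hu0')).const_add 1
    have h4 := (h3.clog_real (hslit u hu0)).const_mul (1 / (p : ℂ))
    have h5 := h1.add h4
    refine (h5.congr_deriv ?_).hasDerivWithinAt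
    rw [sub_eq_add_neg]
    have e1 : (u : ℂ) ^ p + b ≠ 0 := hne u hu0
    have e2 : 1 + b / (u : ℂ) ^ p = ((u : ℂ) ^ p + b) / (u : ℂ) ^ p := by field_simp
    have e3 : (u : ℂ) ^ p = (u : ℂ) ^ (p - 1) * u := by rw [← pow_succ]; congr 1; omega
    rw [e2, hF]
    simp only
    rw [e3] at e1 ⊢
    field_simp
    ring
  have hbound : ∀ u ∈ Set.Ico (m : ℝ) (m + 1), ‖F y - F u‖ ≤
      t * ‖β‖ * ((p + 1) * (1 + ‖β‖)) / c ^ 2 * (1 / (m : ℝ) ^ (p + 2)) := by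
    intro u hu
    have hu0 : 0 < u := hm'.trans_le hu.1
    have huy : u ≤ y := hu.2.le
    have hyu : y - u ≤ 1 := by rw [hy]; linarith [hu.1]
    have hu0' : (u : ℂ) ≠ 0 := ofReal_ne_zero.2 hu0.ne'
    have hy0' : (y : ℂ) ≠ 0 := ofReal_ne_zero.2 hy0.ne'
    have e1 : F y - F u = b * (((u ^ (p + 1) - y ^ (p + 1) : ℝ) : ℂ) + b * ((u - y : ℝ) : ℂ)) /
        (u * ((u : ℂ) ^ p + b) * (y * ((y : ℂ) ^ p + b))) := by
      rw [hF]
      simp only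
      have := hne u hu0
      have := hne y hy0
      rw [div_sub_div _ _ (by simp_all) (by simp_all)]
      push_cast
      rw [mul_comm ((y : ℂ) * _)]
      congr 1 <;> ring
    have e2 : ‖((u ^ (p + 1) - y ^ (p + 1) : ℝ) : ℂ)‖ ≤ (p + 1) * y ^ p := by
      rw [norm_real, Real.norm_eq_abs, abs_sub_comm,
        abs_of_nonneg (sub_nonneg.2 (pow_le_pow_left₀ hu0.le huy _)), ← (Commute.all y u).mul_geom_sum₂]
      calc (y - u) * ∑ i ∈ Finset.range (p + 1), y ^ i * u ^ (p + 1 - 1 - i)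
          ≤ 1 * ∑ i ∈ Finset.range (p + 1), y ^ p := by
            gcongr with i hi
            have hi' := Finset.mem_range.1 hi
            calc y ^ i * u ^ (p + 1 - 1 - i) ≤ y ^ i * y ^ (p + 1 - 1 - i) := by gcongr
              _ = y ^ p := by rw [← pow_add]; congr 1; omega
        _ = _ := by simp
    have nb : ‖b‖ = t * ‖β‖ := by rw [hb, norm_mul, norm_real, Real.norm_of_nonneg ht]
    have e3 : ‖b * ((u - y : ℝ) : ℂ)‖ ≤ t * ‖β‖ := by
      rw [norm_mul, norm_real, Real.norm_eq_abs, abs_sub_comm, abs_of_nonneg (by linarith), nb]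
      exact mul_le_of_le_one_right (by positivity) hyu
    -- The factor `y ^ p + t` is kept because it cancels the lower bound for `‖y ^ p + b‖`; no
    -- second power of `t` survives.
    have e4 : ‖((u ^ (p + 1) - y ^ (p + 1) : ℝ) : ℂ) + b * ((u - y : ℝ) : ℂ)‖ ≤
        (p + 1) * (1 + ‖β‖) * (y ^ p + t) := by
      refine (norm_add_le _ _).trans ((add_le_add e2 e3).trans ?_)
      have a1 : 0 ≤ (p + 1 : ℝ) * (‖β‖ * y ^ p) := by positivity
      have a2 : 0 ≤ (p + 1 : ℝ) * t := by positivity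
      have a3 : 0 ≤ (p : ℝ) * (‖β‖ * t) := by positivity
      nlinarith
    have e5 : c * (m : ℝ) ^ p ≤ ‖(u : ℂ) ^ p + b‖ := by
      refine le_trans ?_ (hnorm u hu0.le)
      have : (m : ℝ) ^ p ≤ u ^ p := pow_le_pow_left₀ hm'.le hu.1 p
      gcongr; linarith
    have hyp : 0 < y ^ p + t := by positivity
    rw [e1, norm_div, norm_mul, norm_mul, norm_mul, norm_mul, norm_real, norm_real,
      Real.norm_of_nonneg hu0.le, Real.norm_of_nonneg hy0.le, nb]
    calc _ ≤ t * ‖β‖ * ((p + 1) * (1 + ‖β‖) * (y ^ p + t)) /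
          (m * (c * (m : ℝ) ^ p) * (m * (c * (y ^ p + t)))) := by
          gcongr
          · exact hu.1
          · rw [hy]; linarith
          · exact hnorm y hy0.le
      _ = _ := by
          rw [pow_add]; field_simp
  have hfin := norm_image_sub_le_of_norm_deriv_le_segment' hder hbound (m + 1) ⟨by linarith, le_rfl⟩
  refine le_trans (le_of_eq ?_) (hfin.trans (le_of_eq (by ring)))
  congr 1
  rw [hFy]
  push_cast
  ring

theorem tendsto_log_one_add_div_pow (b : ℂ) {p : ℕ} (hp : p ≠ 0) (Y : ℕ) :
    Tendsto (fun M : ℕ => log (1 + b / ((Y + M : ℕ) : ℂ) ^ p)) atTop (𝓝 0) := by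
  have h1 : Tendsto (fun M : ℕ => b * (((Y + M : ℕ) : ℂ)⁻¹) ^ p) atTop (𝓝 0) := by
    have h0 : Tendsto (fun M : ℕ => ((Y + M : ℕ) : ℂ)⁻¹) atTop (𝓝 0) := by
      simpa only [add_comm Y, Function.comp_def] using
        (tendsto_inv_atTop_nhds_zero_nat (𝕜 := ℂ)).comp (tendsto_add_atTop_nat Y)
    simpa [hp] using (h0.pow p).const_mul b
  have h2 := (h1.const_add 1).clog (by simp)
  simpa [div_eq_mul_inv] using h2

/-- The tail of the series of `rationalTerm`, compared with the integral. -/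
theorem exists_norm_tsum_rationalTerm_sub_log_le {β : ℂ} (hβ : β ∈ slitPlane) {p : ℕ}
    (hp : p ≠ 0) : ∃ C : ℝ, 0 ≤ C ∧ ∀ t : ℝ, 0 < t → ∀ Y : ℕ, Y ≠ 0 →
      ‖∑' m : ℕ, rationalTerm p (t * β) (Y + m + 1) - 1 / p * log (1 + t * β / (Y : ℂ) ^ p)‖ ≤
        C * t / (Y : ℝ) ^ (p + 1) := by
  obtain ⟨c, hc, hcβ⟩ := exists_pos_mul_add_le_norm hβ
  set K : ℝ := ‖β‖ * ((p + 1) * (1 + ‖β‖)) / c ^ 2 with hK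
  have hK0 : 0 ≤ K := by positivity
  refine ⟨2 * K, by positivity, fun t ht Y hY => ?_⟩
  have hY1 : (1 : ℝ) ≤ Y := by exact_mod_cast Nat.one_le_iff_ne_zero.2 hY
  have hY0 : (0 : ℝ) < Y := by linarith
  have hs := (summable_nat_add_iff Y).2 (summable_rationalTerm (ofReal_mul_mem_slitPlane hβ ht) hp)
  simp only [add_comm _ Y] at hs
  have h1 := (hs.hasSum.tendsto_sum_nat.sub_const (1 / p * log (1 + t * β / (Y : ℂ) ^ p))).add
    ((tendsto_log_one_add_div_pow (t * β) hp Y).const_mul (1 / (p : ℂ)))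
  rw [mul_zero, add_zero] at h1
  refine le_of_tendsto h1.norm (Eventually.of_forall fun M => ?_)
  have h2 := Finset.sum_range_sub' (fun m => log (1 + t * β / ((Y + m : ℕ) : ℂ) ^ p)) M
  have h3 : ∑ m ∈ Finset.range M, rationalTerm p (t * β) (Y + m + 1) -
      1 / p * log (1 + t * β / (Y : ℂ) ^ p) +
      1 / p * log (1 + t * β / ((Y + M : ℕ) : ℂ) ^ p) =
      ∑ m ∈ Finset.range M, (rationalTerm p (t * β) (Y + m + 1) -
        1 / p * (log (1 + t * β / ((Y + m : ℕ) : ℂ) ^ p) -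
          log (1 + t * β / ((Y + (m + 1) : ℕ) : ℂ) ^ p))) := by
    rw [Finset.sum_sub_distrib, ← Finset.mul_sum, h2, add_zero]
    ring
  rw [h3]
  refine (norm_sum_le _ _).trans ?_
  calc _ ≤ ∑ m ∈ Finset.range M, t * K / (Y : ℝ) ^ p * (1 / ((m : ℝ) + Y) ^ 2) := by
        refine Finset.sum_le_sum fun m _ => ?_
        refine (norm_rationalTerm_sub_log_le hβ hc hcβ ht.le hp (by omega : Y + m ≠ 0)).trans ?_
        have h4 : (Y : ℝ) ^ p * ((m : ℝ) + Y) ^ 2 ≤ ((Y + m : ℕ) : ℝ) ^ (p + 2) := by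
          rw [pow_add]
          push_cast
          rw [add_comm (m : ℝ)]
          gcongr
          linarith [m.cast_nonneg (α := ℝ)]
        calc _ = t * K * (1 / ((Y + m : ℕ) : ℝ) ^ (p + 2)) := by rw [hK]; ring
          _ ≤ t * K * (1 / ((Y : ℝ) ^ p * ((m : ℝ) + Y) ^ 2)) := by gcongr
          _ = _ := by field_simp
    _ ≤ t * K / (Y : ℝ) ^ p * (2 / Y) := by
        rw [← Finset.mul_sum]
        gcongr
        exact sum_inv_add_sq_le hY1 M
    _ = _ := by rw [pow_succ]; field_simp

/-! ### Riemann sums and the dilogarithm. -/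

theorem tendsto_riemann_sum {h : ℝ → ℂ} (hh : ContinuousOn h (Set.Icc 0 1)) :
    Tendsto (fun M : ℕ => (1 / (M : ℂ)) * ∑ n ∈ Finset.range M, h (((n + 1 : ℕ) : ℝ) / M)) atTop
      (𝓝 (∫ u in (0 : ℝ)..1, h u)) := by
  have huc := isCompact_Icc.uniformContinuousOn_of_continuous hh
  rw [Metric.tendsto_atTop]
  intro ε hε
  obtain ⟨δ, hδ, hδ'⟩ := Metric.uniformContinuousOn_iff.1 huc (ε / 2) (by positivity)
  obtain ⟨M₀, hM₀⟩ := exists_nat_gt (1 / δ)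
  refine ⟨M₀ + 1, fun M hM => ?_⟩
  have hMpos : (0 : ℝ) < M := by exact_mod_cast (by omega : 0 < M)
  have hMδ : 1 / (M : ℝ) < δ := by
    have : (M₀ : ℝ) < M := by exact_mod_cast (by omega : M₀ < M)
    rw [div_lt_comm₀ hMpos hδ]; linarith
  have hmem : ∀ k : ℕ, k ≤ M → (k : ℝ) / M ∈ Set.Icc (0 : ℝ) 1 := fun k hk =>
    ⟨by positivity, by rw [div_le_one hMpos]; exact_mod_cast hk⟩
  have hle : ∀ k : ℕ, (k : ℝ) / M ≤ ((k + 1 : ℕ) : ℝ) / M := fun k => by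
    gcongr; linarith
  have hsub : ∀ k < M, Set.uIcc ((k : ℝ) / M) (((k + 1 : ℕ) : ℝ) / M) ⊆ Set.Icc 0 1 := fun k hk => by
    rw [Set.uIcc_of_le (hle k)]
    exact Set.Icc_subset_Icc (hmem k hk.le).1 (hmem (k + 1) hk).2
  have hint : ∀ k < M, IntervalIntegrable h MeasureTheory.volume ((k : ℝ) / M)
      (((k + 1 : ℕ) : ℝ) / M) := fun k hk => (hh.mono (hsub k hk)).intervalIntegrable
  have hsplit := intervalIntegral.sum_integral_adjacent_intervals (a := fun k : ℕ => (k : ℝ) / M) hint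
  simp only [Nat.cast_zero, zero_div, div_self hMpos.ne'] at hsplit
  have hconst : ∀ k : ℕ, (1 / (M : ℂ)) * h (((k + 1 : ℕ) : ℝ) / M) =
      ∫ _ in ((k : ℝ) / M)..(((k + 1 : ℕ) : ℝ) / M), h (((k + 1 : ℕ) : ℝ) / M) := by
    intro k
    have : ((k + 1 : ℕ) : ℝ) / M - (k : ℝ) / M = 1 / M := by push_cast; ring
    rw [intervalIntegral.integral_const, this, real_smul]
    push_cast
    rfl
  rw [dist_eq_norm, ← hsplit, Finset.mul_sum, ← Finset.sum_sub_distrib]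
  have hterm : ∀ k ∈ Finset.range M, ‖(1 / (M : ℂ)) * h (((k + 1 : ℕ) : ℝ) / M) -
      ∫ u in ((k : ℝ) / M)..(((k + 1 : ℕ) : ℝ) / M), h u‖ ≤ ε / 2 * (1 / M) := by
    intro k hk
    have hk' := Finset.mem_range.1 hk
    rw [hconst, ← intervalIntegral.integral_sub (by simp) (hint k hk')]
    have hlen : |((k + 1 : ℕ) : ℝ) / M - (k : ℝ) / M| = 1 / M := by
      rw [abs_of_nonneg (sub_nonneg.2 (hle k))]; push_cast; ring
    refine (intervalIntegral.norm_integral_le_of_norm_le_const (C := ε / 2) fun u hu => ?_).trans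
      (le_of_eq (by rw [hlen]))
    rw [Set.uIoc_of_le (hle k)] at hu
    have hu' : u ∈ Set.Icc (0 : ℝ) 1 :=
      ⟨(hmem k hk'.le).1.trans hu.1.le, hu.2.trans (hmem (k + 1) hk').2⟩
    rw [← dist_eq_norm]
    refine (hδ' _ (hmem (k + 1) hk') _ hu' ?_).le
    rw [Real.dist_eq, abs_of_nonneg (by linarith [hu.2])]
    refine lt_of_le_of_lt ?_ hMδ
    have : ((k + 1 : ℕ) : ℝ) / M - (k : ℝ) / M = 1 / M := by push_cast; ring
    linarith [hu.1]
  refine ((norm_sum_le _ _).trans (Finset.sum_le_sum hterm)).trans_lt ?_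
  rw [Finset.sum_const, Finset.card_range, nsmul_eq_mul]
  have : (M : ℝ) * (ε / 2 * (1 / M)) = ε / 2 := by field_simp
  rw [this]
  linarith

/-- `∫₀¹ log (1 + β u ^ p) / u du`, that is `-Li₂(-β) / p`. -/
noncomputable def logIntegral (p : ℕ) (β : ℂ) : ℂ :=
  ∫ u in (0 : ℝ)..1, log (1 + β * (u : ℂ) ^ p) / u

theorem one_add_mul_pow_mem_slitPlane {β : ℂ} (hβ : β ∈ slitPlane) (p : ℕ) {u : ℝ} (hu : 0 ≤ u) :
    1 + β * (u : ℂ) ^ p ∈ slitPlane := by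
  have := ofReal_add_ofReal_mul_mem_slitPlane hβ zero_le_one (t := u ^ p) (by positivity)
    (by positivity)
  simpa [mul_comm] using this

theorem inv_mem_slitPlane' {β : ℂ} (hβ : β ∈ slitPlane) : β⁻¹ ∈ slitPlane := by
  have h0 : 0 < normSq β := normSq_pos.2 (slitPlane_ne_zero hβ)
  rw [mem_slitPlane_iff] at hβ ⊢
  rw [inv_re, inv_im]
  rcases hβ with h | h
  · left; positivity
  · right; exact div_ne_zero (neg_ne_zero.2 h) h0.ne'

theorem hasDerivAt_log_one_add_mul_pow (β : ℂ) (p : ℕ) {u : ℝ}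
    (hu : 1 + β * (u : ℂ) ^ p ∈ slitPlane) :
    HasDerivAt (fun u : ℝ => log (1 + β * (u : ℂ) ^ p))
      (β * (p * (u : ℂ) ^ (p - 1)) / (1 + β * (u : ℂ) ^ p)) u := by
  have h2 : HasDerivAt (fun u : ℝ => (u : ℂ) ^ p) (p * (u : ℂ) ^ (p - 1)) u := by
    simpa using! (ofRealCLM.hasDerivAt (x := u)).pow p
  exact ((h2.const_mul β).const_add 1).clog_real hu

theorem continuousOn_log_one_add_div {β : ℂ} (hβ : β ∈ slitPlane) {p : ℕ} (hp : 2 ≤ p) :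
    ContinuousOn (fun u : ℝ => log (1 + β * (u : ℂ) ^ p) / u) (Set.Icc 0 1) := by
  set f : ℝ → ℂ := fun u => log (1 + β * (u : ℂ) ^ p) with hf
  set s : Set ℝ := {u : ℝ | 1 + β * (u : ℂ) ^ p ∈ slitPlane} with hs
  have hso : IsOpen s := isOpen_slitPlane.preimage (by fun_prop)
  have hsub : Set.Icc 0 1 ⊆ s := fun u hu => one_add_mul_pow_mem_slitPlane hβ p hu.1
  have hd : ∀ u ∈ s, HasDerivAt f (β * (p * (u : ℂ) ^ (p - 1)) / (1 + β * (u : ℂ) ^ p)) u :=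
    fun u hu => hasDerivAt_log_one_add_mul_pow β p hu
  have h0 : (0 : ℝ) ∈ s := hsub ⟨le_rfl, zero_le_one⟩
  have hc := (continuousOn_dslope (hso.mem_nhds h0)).2
    ⟨fun u hu => (hd u hu).continuousAt.continuousWithinAt, (hd 0 h0).differentiableAt⟩
  refine (hc.mono hsub).congr fun u _ => ?_
  rcases eq_or_ne u 0 with rfl | hu
  -- The derivative at `0` vanishes because `p ≥ 2`, in agreement with the convention `0 / 0 = 0`.
  · rw [dslope_same, (hd 0 h0).deriv]
    simp [show p - 1 ≠ 0 by omega]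
  · rw [dslope_of_ne _ hu, slope_def_module]
    simp only [hf, ofReal_zero, ne_eq, show p ≠ 0 by omega, not_false_eq_true, zero_pow, mul_zero,
      add_zero, log_one, sub_zero, real_smul, ofReal_inv]
    rw [div_eq_inv_mul]

/-- Differentiation under the integral sign gives `u ^ (p - 1) / (1 + β u ^ p)`, which has the
elementary primitive `log (1 + β u ^ p) / (p β)`. -/
theorem hasDerivAt_logIntegral {β : ℂ} (hβ : β ∈ slitPlane) {p : ℕ} (hp : 2 ≤ p) :
    HasDerivAt (logIntegral p) (log (1 + β) / (p * β)) β := by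
  have hp0 : p ≠ 0 := by omega
  have hp0' : (p : ℂ) ≠ 0 := by exact_mod_cast hp0
  have hβ0 := slitPlane_ne_zero hβ
  obtain ⟨r, hr, hball⟩ := Metric.nhds_basis_closedBall.mem_iff.1 (isOpen_slitPlane.mem_nhds hβ)
  have hcont : ContinuousOn (fun q : ℂ × ℝ => (q.2 : ℂ) ^ (p - 1) / (1 + q.1 * (q.2 : ℂ) ^ p))
      (Metric.closedBall β r ×ˢ Set.Icc 0 1) :=
    ContinuousOn.div (by fun_prop) (by fun_prop) fun q hq =>
      slitPlane_ne_zero (one_add_mul_pow_mem_slitPlane (hball hq.1) p hq.2.1)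
  obtain ⟨B, hB⟩ := ((isCompact_closedBall β r).prod isCompact_Icc).exists_bound_of_continuousOn hcont
  have hI : Set.uIoc (0 : ℝ) 1 = Set.Ioc 0 1 := Set.uIoc_of_le zero_le_one
  have hcF' : ContinuousOn (fun u : ℝ => (u : ℂ) ^ (p - 1) / (1 + β * (u : ℂ) ^ p)) (Set.Icc 0 1) :=
    ContinuousOn.div (by fun_prop) (by fun_prop) fun u hu =>
      slitPlane_ne_zero (one_add_mul_pow_mem_slitPlane hβ p hu.1)
  have key := (intervalIntegral.hasDerivAt_integral_of_dominated_loc_of_deriv_le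
    (μ := MeasureTheory.volume) (a := 0) (b := 1)
    (F := fun (β : ℂ) (u : ℝ) => log (1 + β * (u : ℂ) ^ p) / u)
    (F' := fun (β : ℂ) (u : ℝ) => (u : ℂ) ^ (p - 1) / (1 + β * (u : ℂ) ^ p))
    (x₀ := β) (bound := fun _ => B) (Metric.closedBall_mem_nhds β hr) ?_ ?_ ?_ ?_ ?_ ?_).2
  · have hval : ∫ u in (0 : ℝ)..1, (u : ℂ) ^ (p - 1) / (1 + β * (u : ℂ) ^ p) =
        log (1 + β) / (p * β) := by
      rw [intervalIntegral.integral_eq_sub_of_hasDerivAt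
        (f := fun u : ℝ => log (1 + β * (u : ℂ) ^ p) / (p * β))]
      · simp [hp0]
      · intro u hu
        rw [Set.uIcc_of_le zero_le_one] at hu
        have hm := one_add_mul_pow_mem_slitPlane hβ p hu.1
        have := slitPlane_ne_zero hm
        refine ((hasDerivAt_log_one_add_mul_pow β p hm).div_const _).congr_deriv ?_
        field_simp
      · exact ContinuousOn.intervalIntegrable (by rwa [Set.uIcc_of_le zero_le_one])
    rw [← hval]
    exact key
  · filter_upwards [isOpen_slitPlane.mem_nhds hβ] with b hb
    rw [hI]
    exact ((continuousOn_log_one_add_div hb hp).mono Set.Ioc_subset_Icc_self).aestronglyMeasurable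
      measurableSet_Ioc
  · exact ContinuousOn.intervalIntegrable (by
      rw [Set.uIcc_of_le zero_le_one]; exact continuousOn_log_one_add_div hβ hp)
  · rw [hI]
    exact (hcF'.mono Set.Ioc_subset_Icc_self).aestronglyMeasurable measurableSet_Ioc
  · refine MeasureTheory.ae_of_all _ fun u hu b hb => ?_
    rw [hI] at hu
    exact hB (b, u) ⟨hb, hu.1.le, hu.2⟩
  · simp
  · refine MeasureTheory.ae_of_all _ fun u hu b hb => ?_
    rw [hI] at hu
    have hm := one_add_mul_pow_mem_slitPlane (hball hb) p hu.1.le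
    have hu0 : (u : ℂ) ≠ 0 := ofReal_ne_zero.2 hu.1.ne'
    have h1 : HasDerivAt (fun b : ℂ => 1 + b * (u : ℂ) ^ p) ((u : ℂ) ^ p) b := by
      simpa using ((hasDerivAt_id b).mul_const ((u : ℂ) ^ p)).const_add 1
    refine ((h1.clog hm).div_const (u : ℂ)).congr_deriv ?_
    have := slitPlane_ne_zero hm
    have e3 : (u : ℂ) ^ p = (u : ℂ) ^ (p - 1) * u := by rw [← pow_succ]; congr 1; omega
    rw [e3] at this ⊢
    field_simp

/-- The slit plane is star-shaped about `1`, so identities on it follow by differentiation and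
evaluation at `1`. -/
theorem eqOn_slitPlane_of_hasDerivAt_zero {f : ℂ → ℂ} (hf : ∀ z ∈ slitPlane, HasDerivAt f 0 z)
    {z : ℂ} (hz : z ∈ slitPlane) : f z = f 1 :=
  isOpen_slitPlane.is_const_of_deriv_eq_zero
    (starConvex_one_slitPlane.isPathConnected one_mem_slitPlane).isConnected.isPreconnected
    (fun z hz => (hf z hz).differentiableAt.differentiableWithinAt) (fun z hz => (hf z hz).deriv)
    hz one_mem_slitPlane

theorem log_one_add_sub_log_one_add_inv {β : ℂ} (hβ : β ∈ slitPlane) :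
    log (1 + β) - log (1 + β⁻¹) = log β := by
  have h : ∀ z ∈ slitPlane,
      HasDerivAt (fun z : ℂ => log (1 + z) - log (1 + z⁻¹) - log z) 0 z := by
    intro z hz
    have h0 := slitPlane_ne_zero hz
    have h1 : 1 + z ∈ slitPlane := by
      simpa using one_add_mul_pow_mem_slitPlane hz 1 zero_le_one
    have h2 : 1 + z⁻¹ ∈ slitPlane := by
      simpa using one_add_mul_pow_mem_slitPlane (inv_mem_slitPlane' hz) 1 zero_le_one
    refine (((((hasDerivAt_id z).const_add 1).clog h1).sub
      (((hasDerivAt_inv h0).const_add 1).clog h2)).sub (hasDerivAt_log hz)).congr_deriv ?_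
    have h1' := slitPlane_ne_zero h1
    have h2' : 1 + z⁻¹ = (1 + z) / z := by field_simp; ring
    simp only [id]
    rw [h2']
    field_simp
    ring
  have := eqOn_slitPlane_of_hasDerivAt_zero h hβ
  simp only [inv_one, sub_self, log_one] at this
  exact sub_eq_zero.1 this

/-- The alternating sum is `ζ(2)` minus twice its even part `ζ(2) / 4`; the terms at `n = 0` are `0`
by convention. -/
theorem hasSum_alternating_inv_sq :
    HasSum (fun n : ℕ => (-1 : ℂ) ^ (n + 1) / (n : ℂ) ^ 2) ((Real.pi : ℂ) ^ 2 / 12) := by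
  have h1 : HasSum (fun n : ℕ => 1 / (n : ℂ) ^ 2) ((Real.pi : ℂ) ^ 2 / 6) := by
    have := hasSum_ofReal.2 hasSum_zeta_two
    simpa using this
  have h2 : HasSum (fun n : ℕ => if Even n then 1 / (n : ℂ) ^ 2 else 0)
      ((Real.pi : ℂ) ^ 2 / 24) := by
    have hinj : Function.Injective (fun k : ℕ => 2 * k) := fun a b h => by simpa using h
    rw [← hinj.hasSum_iff (f := fun n : ℕ => if Even n then 1 / (n : ℂ) ^ 2 else 0)]
    · convert! h1.mul_left (1 / 4) using 1
      · ext k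
        simp only [Function.comp_apply, even_two_mul, if_true, Nat.cast_mul, Nat.cast_ofNat]
        ring
      · ring
    · intro n hn
      rw [if_neg]
      rintro ⟨k, hk⟩
      exact hn ⟨k, by simp only; omega⟩
  convert! h1.sub (h2.mul_left 2) using 1
  · ext n
    split_ifs with hn
    · rw [hn.add_one.neg_one_pow]; ring
    · rw [(Nat.not_even_iff_odd.1 hn).add_one.neg_one_pow]; ring
  · ring

theorem logIntegral_one {p : ℕ} (hp : p ≠ 0) : logIntegral p 1 = Real.pi ^ 2 / 12 / p := by
  set F : ℕ → ℝ → ℂ := fun n u => (-1) ^ (n + 1) / (n : ℂ) * ((u ^ (p * n - 1) : ℝ) : ℂ) with hF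
  have hint : ∀ n : ℕ, ∫ u in (0 : ℝ)..1, u ^ (p * n - 1) = 1 / ((p * n - 1 : ℕ) + 1 : ℝ) := by
    intro n; simp
  have hcast : ∀ n : ℕ, n ≠ 0 → ((p * n - 1 : ℕ) : ℝ) + 1 = p * n := fun n hn => by
    have : 0 < p * n := Nat.mul_pos (by omega) (by omega)
    rw [Nat.cast_pred this]; push_cast; ring
  have hFint : ∀ n, MeasureTheory.Integrable (F n)
      (MeasureTheory.volume.restrict (Set.Ioc (0 : ℝ) 1)) := fun n => by
    refine (ContinuousOn.integrableOn_Icc ?_).mono_set Set.Ioc_subset_Icc_self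
    fun_prop
  have hnorm : ∀ n, ∫ u in Set.Ioc (0 : ℝ) 1, ‖F n u‖ = 1 / p * (1 / (n : ℝ) ^ 2) := by
    intro n
    rcases eq_or_ne n 0 with rfl | hn
    · simp [hF]
    have h1 : ∫ u in Set.Ioc (0 : ℝ) 1, ‖F n u‖ =
        ∫ u in Set.Ioc (0 : ℝ) 1, 1 / (n : ℝ) * u ^ (p * n - 1) := by
      refine MeasureTheory.setIntegral_congr_fun measurableSet_Ioc fun u hu => ?_
      simp only [hF]
      rw [norm_mul, norm_div, norm_pow, norm_neg, norm_one, one_pow, norm_real, norm_natCast,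
        Real.norm_of_nonneg (pow_nonneg hu.1.le _)]
    rw [h1, MeasureTheory.integral_const_mul, ← intervalIntegral.integral_of_le zero_le_one, hint,
      hcast n hn]
    field_simp
  have hsumm : Summable fun n => ∫ u in Set.Ioc (0 : ℝ) 1, ‖F n u‖ := by
    simp_rw [hnorm]
    exact (Real.summable_one_div_nat_pow.2 one_lt_two).mul_left _
  have key := MeasureTheory.hasSum_integral_of_summable_integral_norm hFint hsumm
  have hval : ∀ n, ∫ u in Set.Ioc (0 : ℝ) 1, F n u = 1 / p * ((-1) ^ (n + 1) / (n : ℂ) ^ 2) := by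
    intro n
    rcases eq_or_ne n 0 with rfl | hn
    · simp [hF]
    simp only [hF]
    rw [MeasureTheory.integral_const_mul, integral_complex_ofReal,
      ← intervalIntegral.integral_of_le zero_le_one, hint, hcast n hn]
    push_cast
    field_simp
  simp_rw [hval] at key
  have h3 := key.unique (hasSum_alternating_inv_sq.mul_left (1 / (p : ℂ)))
  have h4 : logIntegral p 1 = ∫ u in Set.Ioc (0 : ℝ) 1, ∑' n, F n u := by
    -- The endpoint `1` is dropped because the Taylor series of the logarithm is used for `|u ^ p| <
    -- 1`.
    rw [logIntegral, intervalIntegral.integral_of_le zero_le_one,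
      MeasureTheory.integral_Ioc_eq_integral_Ioo, MeasureTheory.integral_Ioc_eq_integral_Ioo]
    refine MeasureTheory.setIntegral_congr_fun measurableSet_Ioo fun u hu => ?_
    have hu0 : (u : ℂ) ≠ 0 := ofReal_ne_zero.2 hu.1.ne'
    have hlt : ‖(u : ℂ) ^ p‖ < 1 := by
      rw [norm_pow, norm_real, Real.norm_of_nonneg hu.1.le]
      exact pow_lt_one₀ hu.1.le hu.2 hp
    have h5 := (hasSum_taylorSeries_log hlt).div_const (u : ℂ)
    simp only [one_mul]
    rw [← h5.tsum_eq]
    refine tsum_congr fun n => ?_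
    rcases eq_or_ne n 0 with rfl | hn
    · simp [hF]
    have e : ((u : ℂ) ^ p) ^ n = (u : ℂ) ^ (p * n - 1) * u := by
      have : 0 < p * n := Nat.mul_pos (by omega) (by omega)
      rw [← pow_mul, ← pow_succ]; congr 1; omega
    simp only [hF]
    rw [e]
    push_cast
    field_simp
  rw [h4, h3]
  ring

/-- The inversion formula of the dilogarithm. -/
theorem logIntegral_add_logIntegral_inv {β : ℂ} (hβ : β ∈ slitPlane) {p q : ℕ} (hp : 2 ≤ p)
    (hq : 2 ≤ q) :
    p * logIntegral p β + q * logIntegral q β⁻¹ = Real.pi ^ 2 / 6 + log β ^ 2 / 2 := by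
  have hp0 : (p : ℂ) ≠ 0 := by exact_mod_cast (by omega : p ≠ 0)
  have hq0 : (q : ℂ) ≠ 0 := by exact_mod_cast (by omega : q ≠ 0)
  -- The derivative is `(log (1 + z) - log (1 + z⁻¹) - log z) / z = 0`. The exponents may differ
  -- since `p * logIntegral p` has a derivative free of `p`.
  have h : ∀ z ∈ slitPlane, HasDerivAt (fun z : ℂ =>
      p * logIntegral p z + q * logIntegral q z⁻¹ - log z ^ 2 / 2) 0 z := by
    intro z hz
    have h0 := slitPlane_ne_zero hz
    have h1 := (hasDerivAt_logIntegral hz hp).const_mul (p : ℂ)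
    have h2 := ((hasDerivAt_logIntegral (inv_mem_slitPlane' hz) hq).comp z
      (hasDerivAt_inv h0)).const_mul (q : ℂ)
    have h3 := ((hasDerivAt_log hz).pow 2).div_const 2
    refine ((h1.add h2).sub h3).congr_deriv ?_
    have h4 := log_one_add_sub_log_one_add_inv hz
    rw [← h4]
    field_simp
    ring
  have := eqOn_slitPlane_of_hasDerivAt_zero h hβ
  simp only [inv_one, log_one, logIntegral_one (show p ≠ 0 by omega),
    logIntegral_one (show q ≠ 0 by omega)] at this
  rw [sub_eq_iff_eq_add] at this
  rw [this]
  field_simp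
  ring

/-! ### The first Stieltjes constant as a limit. -/

/-- The entire function `u ↦ ((n + 1) ^ u - n ^ u) / u = ∫ x in n..n + 1, x ^ (u - 1)`. -/
noncomputable def powSlope (n : ℕ) : ℂ → ℂ :=
  dslope (fun u : ℂ => ((n + 1 : ℕ) : ℂ) ^ u - (n : ℂ) ^ u) 0

/-- The summand `n⁻ˢ - ∫ x in n..n + 1, x⁻ˢ` of the series for `ζ(s) - 1 / (s - 1)`. -/
noncomputable def zetaTerm (n : ℕ) (s : ℂ) : ℂ :=
  1 / (n : ℂ) ^ s - powSlope n (1 - s)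

theorem hasDerivAt_natCast_cpow {n : ℕ} (hn : n ≠ 0) (u : ℂ) :
    HasDerivAt (fun u : ℂ => (n : ℂ) ^ u) ((n : ℂ) ^ u * Real.log n) u := by
  have hn' : (n : ℂ) ≠ 0 := by exact_mod_cast hn
  have := (hasDerivAt_id u).const_cpow (c := (n : ℂ)) (Or.inl hn')
  simpa only [mul_one, ← natCast_log] using! this

theorem hasDerivAt_cpow_succ_sub {n : ℕ} (hn : n ≠ 0) (u : ℂ) :
    HasDerivAt (fun u : ℂ => ((n + 1 : ℕ) : ℂ) ^ u - (n : ℂ) ^ u)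
      (((n + 1 : ℕ) : ℂ) ^ u * Real.log (n + 1 : ℕ) - (n : ℂ) ^ u * Real.log n) u :=
  (hasDerivAt_natCast_cpow n.succ_ne_zero u).sub (hasDerivAt_natCast_cpow hn u)

theorem differentiable_powSlope {n : ℕ} (hn : n ≠ 0) : Differentiable ℂ (powSlope n) := by
  have := (Complex.differentiableOn_dslope (s := Set.univ) (c := 0)
    (f := fun u : ℂ => ((n + 1 : ℕ) : ℂ) ^ u - (n : ℂ) ^ u) univ_mem).2
    fun u _ => (hasDerivAt_cpow_succ_sub hn u).differentiableAt.differentiableWithinAt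
  exact differentiableOn_univ.1 this

theorem powSlope_of_ne {n : ℕ} {u : ℂ} (hu : u ≠ 0) :
    powSlope n u = (((n + 1 : ℕ) : ℂ) ^ u - (n : ℂ) ^ u) / u := by
  rw [powSlope, dslope_of_ne _ hu, slope_def_field]
  simp

theorem powSlope_zero {n : ℕ} (hn : n ≠ 0) :
    powSlope n 0 = Real.log (n + 1 : ℕ) - Real.log n := by
  rw [powSlope, dslope_same, (hasDerivAt_cpow_succ_sub hn 0).deriv]
  simp only [cpow_zero, one_mul]

/-- Differentiating `u * powSlope n u` twice at `0` gives `2 * deriv (powSlope n) 0`. -/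
theorem deriv_powSlope_zero {n : ℕ} (hn : n ≠ 0) :
    deriv (powSlope n) 0 = ((Real.log (n + 1 : ℕ) : ℂ) ^ 2 - (Real.log n : ℂ) ^ 2) / 2 := by
  have hd := differentiable_powSlope hn
  have h1 : (fun u : ℂ => ((n + 1 : ℕ) : ℂ) ^ u - (n : ℂ) ^ u) = fun u => u * powSlope n u := by
    ext u
    rcases eq_or_ne u 0 with rfl | hu
    · simp
    · rw [powSlope_of_ne hu, mul_div_cancel₀ _ hu]
  have h2 : (fun u : ℂ => ((n + 1 : ℕ) : ℂ) ^ u * Real.log (n + 1 : ℕ) - (n : ℂ) ^ u * Real.log n) =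
      fun u => powSlope n u + u * deriv (powSlope n) u := by
    ext u
    have a1 := hasDerivAt_cpow_succ_sub hn u
    rw [h1] at a1
    have a2 := (hasDerivAt_id u).mul (hd u).hasDerivAt
    simpa using! a1.unique a2
  have h3 := ((hasDerivAt_natCast_cpow n.succ_ne_zero 0).mul_const (Real.log (n + 1 : ℕ) : ℂ)).sub
    ((hasDerivAt_natCast_cpow hn 0).mul_const (Real.log n : ℂ))
  have h4 : HasDerivAt (fun u => powSlope n u + u * deriv (powSlope n) u)
      (deriv (powSlope n) 0 + (1 * deriv (powSlope n) 0 + 0 * deriv (deriv (powSlope n)) 0)) 0 :=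
    (hd 0).hasDerivAt.add ((hasDerivAt_id (0 : ℂ)).mul (hd.deriv 0).hasDerivAt)
  have h5 := h3.unique (h2 ▸ h4)
  simp only [cpow_zero, one_mul] at h5
  linear_combination -h5 / 2

theorem powSlope_one_sub {n : ℕ} (hn : n ≠ 0) (s : ℂ) :
    powSlope n (1 - s) = ∫ x in (n : ℝ)..(n + 1 : ℕ), (x : ℂ) ^ (-s) := by
  have hn0 : (0 : ℝ) < n := by positivity
  have hle : (n : ℝ) ≤ (n + 1 : ℕ) := by push_cast; linarith
  have h0 : (0 : ℝ) ∉ Set.uIcc (n : ℝ) (n + 1 : ℕ) := by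
    rw [Set.uIcc_of_le hle]; exact fun h => absurd h.1 (by linarith)
  rcases eq_or_ne s 1 with rfl | hs
  · rw [sub_self, powSlope_zero hn]
    have : ∀ x : ℝ, (x : ℂ) ^ (-1 : ℂ) = ((x⁻¹ : ℝ) : ℂ) := fun x => by
      rw [cpow_neg_one, ofReal_inv]
    simp_rw [this]
    rw [intervalIntegral.integral_ofReal, integral_inv h0, Real.log_div (by positivity) hn0.ne']
    push_cast
    rfl
  · rw [integral_cpow (Or.inr ⟨fun h => hs (neg_injective h), h0⟩),
      powSlope_of_ne (sub_ne_zero.2 hs.symm), neg_add_eq_sub]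
    simp

theorem norm_natCast_cpow_neg_sub_le {n : ℕ} (hn : n ≠ 0) {s : ℂ} (hs : 0 ≤ s.re) {x : ℝ}
    (hx : x ∈ Set.Icc (n : ℝ) (n + 1 : ℕ)) :
    ‖(x : ℂ) ^ (-s) - (n : ℂ) ^ (-s)‖ ≤ ‖s‖ * (n : ℝ) ^ (-s.re - 1) := by
  have hn0 : (0 : ℝ) < n := by positivity
  rcases eq_or_ne s 0 with rfl | hs0
  · simp
  have hder : ∀ y ∈ Set.Icc (n : ℝ) (n + 1 : ℕ), HasDerivWithinAt (fun y : ℝ => (y : ℂ) ^ (-s))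
      (-s * (y : ℂ) ^ (-s - 1)) (Set.Icc (n : ℝ) (n + 1 : ℕ)) y := fun y hy =>
    (hasDerivAt_ofReal_cpow_const (hn0.trans_le hy.1).ne' (neg_ne_zero.2 hs0)).hasDerivWithinAt
  have hb : ∀ y ∈ Set.Ico (n : ℝ) (n + 1 : ℕ), ‖-s * (y : ℂ) ^ (-s - 1)‖ ≤
      ‖s‖ * (n : ℝ) ^ (-s.re - 1) := by
    intro y hy
    have hy0 := hn0.trans_le hy.1
    rw [norm_mul, norm_neg, norm_cpow_eq_rpow_re_of_pos hy0]
    simp only [sub_re, neg_re, one_re]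
    gcongr ?_ * ?_
    exact Real.rpow_le_rpow_of_nonpos hn0 hy.1 (by linarith)
  have h := norm_image_sub_le_of_norm_deriv_le_segment' hder hb x hx
  simp only [ofReal_natCast] at h
  refine h.trans (mul_le_of_le_one_right (by positivity) ?_)
  have := hx.2
  push_cast at this
  linarith

/-- The term is the integral of `n⁻ˢ - x⁻ˢ` over a unit interval; the mean value inequality gains a
factor `1 / n`, so the series converges beyond `Re s > 1`, down to `Re s > 0`. -/
theorem norm_zetaTerm_le {n : ℕ} (hn : n ≠ 0) {s : ℂ} (hs : 0 ≤ s.re) :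
    ‖zetaTerm n s‖ ≤ ‖s‖ * (n : ℝ) ^ (-s.re - 1) := by
  have hn0 : (0 : ℝ) < n := by positivity
  have hle : (n : ℝ) ≤ (n + 1 : ℕ) := by push_cast; linarith
  have hone : ((n + 1 : ℕ) : ℝ) - n = 1 := by push_cast; ring
  have hint : IntervalIntegrable (fun x : ℝ => (x : ℂ) ^ (-s)) MeasureTheory.volume n (n + 1 : ℕ) := by
    refine ContinuousOn.intervalIntegrable fun x hx => ?_
    rw [Set.uIcc_of_le hle] at hx
    exact (continuousAt_ofReal_cpow_const _ _
      (Or.inr (hn0.trans_le hx.1).ne')).continuousWithinAt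
  have e : zetaTerm n s = ∫ x in (n : ℝ)..(n + 1 : ℕ), ((n : ℂ) ^ (-s) - (x : ℂ) ^ (-s)) := by
    rw [intervalIntegral.integral_sub (by simp) hint, ← powSlope_one_sub hn,
      intervalIntegral.integral_const, hone, one_smul, zetaTerm, cpow_neg, one_div]
  rw [e]
  refine (intervalIntegral.norm_integral_le_of_norm_le_const fun x hx => ?_).trans
    (le_of_eq (by rw [hone, abs_one, mul_one]))
  rw [Set.uIoc_of_le hle] at hx
  rw [norm_sub_rev]
  exact norm_natCast_cpow_neg_sub_le hn hs ⟨hx.1.le, hx.2⟩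

theorem hasDerivAt_zetaTerm {n : ℕ} (hn : n ≠ 0) (s : ℂ) :
    HasDerivAt (zetaTerm n)
      (-Real.log n / (n : ℂ) ^ s + deriv (powSlope n) (1 - s)) s := by
  have hn' : (n : ℂ) ≠ 0 := by exact_mod_cast hn
  have h0 : (n : ℂ) ^ s ≠ 0 := by simp [cpow_eq_zero_iff, hn]
  have h1 := (hasDerivAt_natCast_cpow hn s).inv h0
  have h2 := ((differentiable_powSlope hn) (1 - s)).hasDerivAt.comp s
    ((hasDerivAt_id s).const_sub 1)
  have h3 := h1.sub h2
  have h4 : zetaTerm n = (fun u : ℂ => (n : ℂ) ^ u)⁻¹ - powSlope n ∘ fun s => 1 - id s := by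
    ext u
    simp [zetaTerm]
  rw [h4]
  refine h3.congr_deriv ?_
  field_simp
  ring

theorem tsum_zetaTerm {s : ℂ} (hs : 1 < s.re)
    (hsum : Summable fun n : ℕ => zetaTerm (n + 1) s) :
    ∑' n : ℕ, zetaTerm (n + 1) s = riemannZeta₀ s := by
  have hs1 : s ≠ 1 := by rintro rfl; simp at hs
  have hs1' : 1 - s ≠ 0 := sub_ne_zero.2 hs1.symm
  have h1 : Tendsto (fun M : ℕ => ∑ n ∈ Finset.range M, 1 / ((n + 1 : ℕ) : ℂ) ^ s) atTop
      (𝓝 (riemannZeta s)) := by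
    have hz := (summable_nat_add_iff 1).2 (summable_one_div_nat_cpow.2 hs)
    have := hz.hasSum.tendsto_sum_nat
    rw [zeta_eq_tsum_one_div_nat_add_one_cpow hs]
    simpa using this
  have h2 : Tendsto (fun M : ℕ => ((M + 1 : ℕ) : ℂ) ^ (1 - s)) atTop (𝓝 0) := by
    rw [tendsto_zero_iff_norm_tendsto_zero]
    have h3 : Tendsto (fun M : ℕ => ((M + 1 : ℕ) : ℝ) ^ (-(s.re - 1))) atTop (𝓝 0) :=
      (tendsto_rpow_neg_atTop (by linarith)).comp
        (tendsto_natCast_atTop_atTop.comp (tendsto_add_atTop_nat 1))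
    refine h3.congr fun M => ?_
    rw [norm_natCast_cpow_of_pos M.succ_pos]
    simp
  have h3 : Tendsto (fun M : ℕ => ∑ n ∈ Finset.range M, zetaTerm (n + 1) s) atTop
      (𝓝 (riemannZeta s - (0 - 1) / (1 - s))) := by
    refine (h1.sub ((h2.sub_const 1).div_const (1 - s))).congr fun M => ?_
    simp only [zetaTerm]
    rw [Finset.sum_sub_distrib]
    congr 1
    simp only [powSlope_of_ne hs1']
    rw [← Finset.sum_div, Finset.sum_range_sub (fun n : ℕ => ((n + 1 : ℕ) : ℂ) ^ (1 - s))]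
    simp
  rw [tendsto_nhds_unique hsum.hasSum.tendsto_sum_nat h3, riemannZeta_eq_inv_sub_add hs1]
  have : s - 1 ≠ 0 := sub_ne_zero.2 hs1
  field_simp
  ring

theorem tendsto_log_natCast_div : Tendsto (fun M : ℕ => Real.log M / M) atTop (𝓝 0) :=
  Real.isLittleO_log_id_atTop.tendsto_div_nhds_zero.comp tendsto_natCast_atTop_atTop

/-- The first Stieltjes constant as a limit. -/
theorem tendsto_stieltjesOne :
    Tendsto (fun M : ℕ => ∑ n ∈ Finset.range M, (Real.log (n + 1 : ℕ) : ℂ) / ((n + 1 : ℕ) : ℂ) -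
      (Real.log M : ℂ) ^ 2 / 2) atTop (𝓝 stieltjesOne) := by
  -- `U` is connected and contains `2`, near which the series is known to be `riemannZeta₀`, and
  -- `1`, where the derivative is needed. `Re s > 1 / 2` and `‖s‖ < 4` give the majorant `4 n ^ (-3
  -- / 2)`.
  set U : Set ℂ := {s | 1 / 2 < s.re} ∩ Metric.ball 0 4 with hU
  have hUo : IsOpen U := (isOpen_lt continuous_const continuous_re).inter Metric.isOpen_ball
  have hUc : Convex ℝ U := (convex_halfSpace_re_gt (1 / 2)).inter (convex_ball 0 4)
  have h1U : (1 : ℂ) ∈ U := by simp [hU]; norm_num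
  have h2U : (2 : ℂ) ∈ U := by simp [hU]; norm_num
  set u : ℕ → ℝ := fun n => 4 * ((n + 1 : ℕ) : ℝ) ^ (-(3 / 2) : ℝ) with hu
  have husum : Summable u :=
    ((summable_nat_add_iff 1).2 (Real.summable_nat_rpow.2 (by norm_num))).mul_left 4
  have hbound : ∀ (n : ℕ) (s : ℂ), s ∈ U → ‖zetaTerm (n + 1) s‖ ≤ u n := by
    intro n s hs
    have hre : 1 / 2 < s.re := hs.1
    have hns : ‖s‖ < 4 := by simpa using hs.2
    refine (norm_zetaTerm_le n.succ_ne_zero (by linarith)).trans ?_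
    have hn1 : (1 : ℝ) ≤ ((n + 1 : ℕ) : ℝ) := by push_cast; linarith [n.cast_nonneg (α := ℝ)]
    simp only [hu]
    gcongr
    linarith
  have hdiff : ∀ n : ℕ, DifferentiableOn ℂ (zetaTerm (n + 1)) U := fun n s _ =>
    (hasDerivAt_zetaTerm n.succ_ne_zero s).differentiableAt.differentiableWithinAt
  have hT := differentiableOn_tsum_of_summable_norm husum hdiff hUo hbound
  have hsum : ∀ s ∈ U, Summable fun n : ℕ => zetaTerm (n + 1) s := fun s hs =>
    Summable.of_norm_bounded husum fun n => hbound n s hs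
  have heq : Set.EqOn (fun s => ∑' n : ℕ, zetaTerm (n + 1) s) riemannZeta₀ U := by
    refine (hT.analyticOnNhd hUo).eqOn_of_preconnected_of_eventuallyEq
      (differentiable_riemannZeta₀.differentiableOn.analyticOnNhd hUo) hUc.isPreconnected h2U ?_
    filter_upwards [hUo.mem_nhds h2U, (isOpen_lt continuous_const continuous_re).mem_nhds
      (show (1 : ℝ) < (2 : ℂ).re by norm_num)] with s hs hs'
    exact tsum_zetaTerm hs' (hsum s hs)
  have hder : deriv (fun s => ∑' n : ℕ, zetaTerm (n + 1) s) 1 = deriv riemannZeta₀ 1 :=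
    (heq.eventuallyEq_of_mem (hUo.mem_nhds h1U)).deriv_eq
  have hS := (hasSum_deriv_of_summable_norm husum hdiff hUo hbound h1U).tendsto_sum_nat
  rw [hder] at hS
  have hpart : ∀ M : ℕ, ∑ n ∈ Finset.range M, deriv (zetaTerm (n + 1)) 1 =
      -(∑ n ∈ Finset.range M, (Real.log (n + 1 : ℕ) : ℂ) / ((n + 1 : ℕ) : ℂ) -
        (Real.log (M + 1 : ℕ) : ℂ) ^ 2 / 2) := by
    intro M
    have h6 := Finset.sum_range_sub (fun n : ℕ => (Real.log (n + 1 : ℕ) : ℂ) ^ 2 / 2) M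
    simp only [zero_add, Nat.cast_one, Real.log_one, ofReal_zero] at h6
    have h7 : ∀ n : ℕ, deriv (zetaTerm (n + 1)) 1 =
        -((Real.log (n + 1 : ℕ) : ℂ) / ((n + 1 : ℕ) : ℂ)) +
        ((Real.log (n + 1 + 1 : ℕ) : ℂ) ^ 2 / 2 - (Real.log (n + 1 : ℕ) : ℂ) ^ 2 / 2) := by
      intro n
      rw [(hasDerivAt_zetaTerm n.succ_ne_zero 1).deriv, sub_self,
        deriv_powSlope_zero n.succ_ne_zero, cpow_one]
      ring
    rw [Finset.sum_congr rfl fun n _ => h7 n, Finset.sum_add_distrib, h6, Finset.sum_neg_distrib]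
    ring
  simp only [hpart] at hS
  -- The telescoped square is `log² (M + 1)` while the sum stops at `M`; the missing term tends to
  -- `0`.
  have hlog : Tendsto (fun M : ℕ => (Real.log (M + 1 : ℕ) : ℂ) / ((M + 1 : ℕ) : ℂ)) atTop (𝓝 0) := by
    have := (continuous_ofReal.tendsto _).comp
      ((tendsto_add_atTop_iff_nat 1).2 tendsto_log_natCast_div)
    rw [ofReal_zero] at this
    exact this.congr fun M => by simp
  rw [← tendsto_add_atTop_iff_nat 1]
  have hfin := hS.neg.add hlog
  rw [add_zero] at hfin
  refine hfin.congr fun M => ?_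
  rw [Finset.sum_range_succ]
  ring

/-! ### Rearrangement of the double series. -/

/-- The inner tail is close to `(1 / p) log (1 + n ^ q β / B ^ p)`, and `A ^ q = B ^ p` makes this a
function of `n / A`; the weights `1 / n` then produce a Riemann sum. The errors total at most `C A ^
q / B ^ (p + 1) = C / B`. -/
theorem tendsto_sum_tsum_rationalTerm {β : ℂ} (hβ : β ∈ slitPlane) {p q : ℕ} (hp : p ≠ 0)
    (hq : 2 ≤ q) {A B : ℕ → ℕ} (hA : Tendsto A atTop atTop) (hB : Tendsto B atTop atTop)
    (hAB : ∀ i, A i ^ q = B i ^ p) :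
    Tendsto (fun i => ∑ n ∈ Finset.range (A i), 1 / ((n + 1 : ℕ) : ℂ) *
      ∑' m : ℕ, rationalTerm p (((((n + 1 : ℕ) : ℝ) ^ q : ℝ) : ℂ) * β) (B i + m + 1)) atTop
      (𝓝 (1 / p * logIntegral q β)) := by
  obtain ⟨C, hC, hbound⟩ := exists_norm_tsum_rationalTerm_sub_log_le hβ hp
  have h1 := (((tendsto_riemann_sum (continuousOn_log_one_add_div hβ hq)).comp hA).const_mul
    (1 / (p : ℂ)))
  have hsmall : Tendsto (fun i => C / (B i : ℝ)) atTop (𝓝 0) :=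
    (tendsto_const_div_atTop_nhds_zero_nat C).comp hB
  have hdiff : Tendsto (fun i => ∑ n ∈ Finset.range (A i), 1 / ((n + 1 : ℕ) : ℂ) *
      (∑' m : ℕ, rationalTerm p (((((n + 1 : ℕ) : ℝ) ^ q : ℝ) : ℂ) * β) (B i + m + 1) -
        1 / p * log (1 + ((((n + 1 : ℕ) : ℝ) ^ q : ℝ) : ℂ) * β / (B i : ℂ) ^ p))) atTop (𝓝 0) := by
    refine squeeze_zero_norm' ?_ hsmall
    filter_upwards [hB.eventually_ne_atTop 0] with i hi
    have hB0 : (0 : ℝ) < B i := by positivity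
    refine (norm_sum_le _ _).trans ?_
    calc _ ≤ ∑ n ∈ Finset.range (A i), C * (A i : ℝ) ^ (q - 1) / (B i : ℝ) ^ (p + 1) := by
          refine Finset.sum_le_sum fun n hn => ?_
          have hnA : ((n + 1 : ℕ) : ℝ) ≤ A i := by
            exact_mod_cast Nat.succ_le_of_lt (Finset.mem_range.1 hn)
          have hn0 : (0 : ℝ) < ((n + 1 : ℕ) : ℝ) := by positivity
          rw [norm_mul, norm_div, norm_one, norm_natCast]
          calc _ ≤ 1 / ((n + 1 : ℕ) : ℝ) * (C * ((n + 1 : ℕ) : ℝ) ^ q / (B i : ℝ) ^ (p + 1)) := by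
                gcongr
                exact hbound _ (by positivity) _ hi
            _ = C * ((n + 1 : ℕ) : ℝ) ^ (q - 1) / (B i : ℝ) ^ (p + 1) := by
                rw [show q = q - 1 + 1 by omega, pow_succ, Nat.add_sub_cancel]
                field_simp
            _ ≤ _ := by gcongr
      _ = C * (A i : ℝ) ^ q / (B i : ℝ) ^ (p + 1) := by
          rw [Finset.sum_const, Finset.card_range, nsmul_eq_mul]
          conv_rhs => rw [show q = q - 1 + 1 by omega, pow_succ]
          ring
      _ = C / B i := by
          have : (A i : ℝ) ^ q = (B i : ℝ) ^ p := by exact_mod_cast hAB i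
          rw [this, pow_succ]
          field_simp
  have h2 := hdiff.add h1
  rw [zero_add] at h2
  refine h2.congr' ?_
  filter_upwards [hA.eventually_ne_atTop 0] with i hi
  have hA0 : (A i : ℂ) ≠ 0 := by exact_mod_cast hi
  have hpow : (A i : ℂ) ^ q = (B i : ℂ) ^ p := by exact_mod_cast hAB i
  simp only [Function.comp_apply, Finset.mul_sum]
  rw [← Finset.sum_add_distrib]
  refine Finset.sum_congr rfl fun n _ => ?_
  have hn0 : ((n + 1 : ℕ) : ℂ) ≠ 0 := by exact_mod_cast n.succ_ne_zero
  have e : β * (((((n + 1 : ℕ) : ℝ) / A i : ℝ) : ℂ)) ^ q =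
      ((((n + 1 : ℕ) : ℝ) ^ q : ℝ) : ℂ) * β / (B i : ℂ) ^ p := by
    rw [← hpow]; push_cast; rw [div_pow]; ring
  rw [e]
  have e2 : ∀ L : ℂ, 1 / (A i : ℂ) * (L / ((((n + 1 : ℕ) : ℝ) / A i : ℝ) : ℂ)) =
      1 / ((n + 1 : ℕ) : ℂ) * L := by
    intro L
    push_cast at hn0 ⊢
    field_simp
  rw [e2]
  ring

theorem rationalTerm_add_rationalTerm {β a b : ℂ} {p q n m : ℕ} (hβ : β ≠ 0)
    (ha : ((n + 1 : ℕ) : ℂ) ^ q = a) (hb : ((m + 1 : ℕ) : ℂ) ^ p = b) (hab : a + b * β ≠ 0) :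
    1 / ((n + 1 : ℕ) : ℂ) * rationalTerm p (a * β⁻¹) (m + 1) +
      1 / ((m + 1 : ℕ) : ℂ) * rationalTerm q (b * β) (n + 1) =
      1 / ((n + 1 : ℕ) : ℂ) * (1 / ((m + 1 : ℕ) : ℂ)) := by
  have hn0 : ((n + 1 : ℕ) : ℂ) ≠ 0 := by exact_mod_cast n.succ_ne_zero
  have hm0 : ((m + 1 : ℕ) : ℂ) ≠ 0 := by exact_mod_cast m.succ_ne_zero
  rw [rationalTerm, rationalTerm, ha, hb]
  have e : b + a * β⁻¹ = (a + b * β) / β := by field_simp; ring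
  have hab' : a + β * b ≠ 0 := by rwa [mul_comm β]
  rw [e]
  field_simp

/-- `H_M - log M - γ = o(1 / log M)`. -/
theorem tendsto_log_mul_harmonic_sub :
    Tendsto (fun M : ℕ => (Real.log M : ℂ) * (∑ j ∈ Finset.range M, 1 / ((j + 1 : ℕ) : ℂ) -
      Real.log M - Real.eulerMascheroniConstant)) atTop (𝓝 0) := by
  have h1 : Tendsto (fun M : ℕ => Real.log M *
      ((harmonic M : ℝ) - Real.log M - Real.eulerMascheroniConstant)) atTop (𝓝 0) := by
    -- `γ` lies between `H_M - log (M + 1)` and `H_M - log M`, which differ by at most `1 / M`.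
    refine squeeze_zero' ?_ ?_ tendsto_log_natCast_div
    · filter_upwards [eventually_gt_atTop 0] with M hM
      have h := Real.eulerMascheroniConstant_lt_eulerMascheroniSeq' M
      rw [Real.eulerMascheroniSeq', if_neg hM.ne'] at h
      exact mul_nonneg (Real.log_natCast_nonneg M) (by linarith)
    · filter_upwards [eventually_gt_atTop 0] with M hM
      have h := Real.eulerMascheroniSeq_lt_eulerMascheroniConstant M
      rw [Real.eulerMascheroniSeq] at h
      have hM0 : (0 : ℝ) < M := by exact_mod_cast hM
      have h2 : Real.log (M + 1) - Real.log M ≤ 1 / M := by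
        rw [← Real.log_div (by positivity) hM0.ne']
        refine (Real.log_le_sub_one_of_pos (by positivity)).trans (le_of_eq ?_)
        field_simp
        ring
      rw [div_eq_mul_one_div]
      exact mul_le_mul_of_nonneg_left (by linarith) (Real.log_natCast_nonneg M)
  refine ((continuous_ofReal.tendsto _).comp h1).congr fun M => ?_
  simp [harmonic]

/-- The rearrangement of the double series over `m, n` with summand `1 / (m n)`, split according to
`1 = n² / (n² + m ^ (2 N) β) + m ^ (2 N) β / (n² + m ^ (2 N) β)`, with `l = log β / 2`. -/
theorem tendsto_rearrangement {N : ℕ} (hN : N ≠ 0) {β l : ℂ} (hβ : β ∈ slitPlane)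
    (hl : log β = 2 * l) :
    Tendsto (fun Y : ℕ =>
      ∑ n ∈ Finset.range (Y ^ N), 1 / ((n + 1 : ℕ) : ℂ) *
        (-2 * N * Real.eulerMascheroniConstant - 2 * (Real.log (n + 1 : ℕ) - l) +
          2 * N * ∑' m : ℕ, rationalTerm (2 * N)
            (((((n + 1 : ℕ) : ℝ) ^ 2 : ℝ) : ℂ) * β⁻¹) (m + 1)) +
      N * ∑ m ∈ Finset.range Y, 1 / ((m + 1 : ℕ) : ℂ) *
        (-2 * Real.eulerMascheroniConstant - 2 * (N * Real.log (m + 1 : ℕ) + l) +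
          2 * ∑' n : ℕ, rationalTerm 2
            (((((m + 1 : ℕ) : ℝ) ^ (2 * N) : ℝ) : ℂ) * β) (n + 1))) atTop
      (𝓝 (Real.pi ^ 2 / 12 + l ^ 2 - 2 * N * Real.eulerMascheroniConstant ^ 2 -
        2 * (N ^ 2 + 1) * stieltjesOne - 2 * (N - 1) * Real.eulerMascheroniConstant * l)) := by
  have hN' : (N : ℂ) ≠ 0 := by exact_mod_cast hN
  have hβ' := inv_mem_slitPlane' hβ
  set γ : ℂ := ((Real.eulerMascheroniConstant : ℝ) : ℂ)
  have hpow : Tendsto (fun Y : ℕ => Y ^ N) atTop atTop := tendsto_pow_atTop hN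
  -- The cutoffs `Y ^ N` and `Y` make `n²` and `m ^ (2N)` reach the same size, so the Riemann sum
  -- lemma applies to both tails.
  have hR1 := tendsto_sum_tsum_rationalTerm hβ' (p := 2 * N) (q := 2) (by omega) le_rfl
    (A := fun Y => Y ^ N) (B := fun Y => Y) hpow tendsto_id (fun Y => by ring)
  have hR2 := tendsto_sum_tsum_rationalTerm hβ (p := 2) (q := 2 * N) (by omega) (by omega)
    (A := fun Y => Y) (B := fun Y => Y ^ N) tendsto_id hpow (fun Y => by ring)
  set R1 : ℕ → ℂ := fun Y => ∑ n ∈ Finset.range (Y ^ N), 1 / ((n + 1 : ℕ) : ℂ) *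
      ∑' m : ℕ, rationalTerm (2 * N) (((((n + 1 : ℕ) : ℝ) ^ 2 : ℝ) : ℂ) * β⁻¹) (Y + m + 1)
  set R2 : ℕ → ℂ := fun Y => ∑ m ∈ Finset.range Y, 1 / ((m + 1 : ℕ) : ℂ) *
      ∑' n : ℕ, rationalTerm 2 (((((m + 1 : ℕ) : ℝ) ^ (2 * N) : ℝ) : ℂ) * β) (Y ^ N + n + 1)
  set H : ℕ → ℂ := fun M => ∑ j ∈ Finset.range M, 1 / ((j + 1 : ℕ) : ℂ) with hH
  set S : ℕ → ℂ := fun M => ∑ n ∈ Finset.range M,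
    (Real.log (n + 1 : ℕ) : ℂ) / ((n + 1 : ℕ) : ℂ) with hS
  have hH1 : Tendsto (fun Y => H Y - Real.log Y) atTop (𝓝 γ) := tendsto_sum_one_div_sub_log
  have hH2 := hH1.comp hpow
  have hS1 : Tendsto (fun Y => S Y - (Real.log Y : ℂ) ^ 2 / 2) atTop (𝓝 stieltjesOne) :=
    tendsto_stieltjesOne
  have hS2 := hS1.comp hpow
  have hE1 : Tendsto (fun Y : ℕ => (Real.log Y : ℂ) * (H Y - Real.log Y - γ)) atTop (𝓝 0) :=
    tendsto_log_mul_harmonic_sub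
  have hE2 := hE1.comp hpow
  have hD := logIntegral_add_logIntegral_inv hβ (p := 2 * N) (q := 2) (by omega) le_rfl
  -- The product of harmonic numbers is expanded about the logarithms; its cross terms have the form
  -- `log M * (H M - log M - γ)` and vanish in the limit. The coefficients are chosen so that all
  -- powers of `log Y` cancel.
  have hlim := (((((hH2.const_mul (-2 * N * γ + 2 * l)).sub (hS2.const_mul 2)).add
    ((hH1.const_mul (N * (-2 * γ - 2 * l))).sub (hS1.const_mul (2 * N ^ 2 : ℂ)))).add
    ((hH2.mul hH1).const_mul (2 * N : ℂ))).add
    ((hE1.const_mul (2 * N ^ 2 : ℂ)).add (hE2.const_mul 2))).add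
    ((hR1.add hR2).const_mul (2 * N : ℂ))
  have hval : (-2 * N * γ + 2 * l) * γ - 2 * stieltjesOne +
      (N * (-2 * γ - 2 * l) * γ - 2 * N ^ 2 * stieltjesOne) + 2 * N * (γ * γ) +
      (2 * N ^ 2 * 0 + 2 * 0) +
      2 * N * (1 / ((2 * N : ℕ) : ℂ) * logIntegral 2 β⁻¹ +
        1 / ((2 : ℕ) : ℂ) * logIntegral (2 * N) β) =
      Real.pi ^ 2 / 12 + l ^ 2 - 2 * N * γ ^ 2 -
        2 * (N ^ 2 + 1) * stieltjesOne - 2 * (N - 1) * γ * l := by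
    rw [hl] at hD
    push_cast at hD ⊢
    have : 2 * (N : ℂ) * (1 / (2 * N) * logIntegral 2 β⁻¹ + 1 / 2 * logIntegral (2 * N) β) =
        logIntegral 2 β⁻¹ + N * logIntegral (2 * N) β := by field_simp
    rw [this]
    linear_combination hD / 2
  rw [hval] at hlim
  refine hlim.congr fun Y => ?_
  have hsplit1 : ∀ n : ℕ, ∑' m : ℕ, rationalTerm (2 * N)
      (((((n + 1 : ℕ) : ℝ) ^ 2 : ℝ) : ℂ) * β⁻¹) (m + 1) =
      ∑ m ∈ Finset.range Y, rationalTerm (2 * N)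
        (((((n + 1 : ℕ) : ℝ) ^ 2 : ℝ) : ℂ) * β⁻¹) (m + 1) +
      ∑' m : ℕ, rationalTerm (2 * N) (((((n + 1 : ℕ) : ℝ) ^ 2 : ℝ) : ℂ) * β⁻¹) (Y + m + 1) := by
    intro n
    rw [← (summable_rationalTerm (ofReal_mul_mem_slitPlane hβ' (t := ((n + 1 : ℕ) : ℝ) ^ 2)
      (by positivity)) (p := 2 * N) (by omega)).sum_add_tsum_nat_add Y]
    simp only [add_comm Y]
  have hsplit2 : ∀ m : ℕ, ∑' n : ℕ, rationalTerm 2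
      (((((m + 1 : ℕ) : ℝ) ^ (2 * N) : ℝ) : ℂ) * β) (n + 1) =
      ∑ n ∈ Finset.range (Y ^ N), rationalTerm 2
        (((((m + 1 : ℕ) : ℝ) ^ (2 * N) : ℝ) : ℂ) * β) (n + 1) +
      ∑' n : ℕ, rationalTerm 2
        (((((m + 1 : ℕ) : ℝ) ^ (2 * N) : ℝ) : ℂ) * β) (Y ^ N + n + 1) := by
    intro m
    rw [← (summable_rationalTerm (ofReal_mul_mem_slitPlane hβ (t := ((m + 1 : ℕ) : ℝ) ^ (2 * N))
      (by positivity)) (p := 2) (by omega)).sum_add_tsum_nat_add (Y ^ N)]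
    simp only [add_comm (Y ^ N)]
  have hdouble : ∑ n ∈ Finset.range (Y ^ N), 1 / ((n + 1 : ℕ) : ℂ) *
        ∑ m ∈ Finset.range Y, rationalTerm (2 * N)
          (((((n + 1 : ℕ) : ℝ) ^ 2 : ℝ) : ℂ) * β⁻¹) (m + 1) +
      ∑ m ∈ Finset.range Y, 1 / ((m + 1 : ℕ) : ℂ) *
        ∑ n ∈ Finset.range (Y ^ N), rationalTerm 2
          (((((m + 1 : ℕ) : ℝ) ^ (2 * N) : ℝ) : ℂ) * β) (n + 1) = H (Y ^ N) * H Y := by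
    simp only [hH]
    rw [Finset.sum_mul_sum]
    simp only [Finset.mul_sum]
    rw [Finset.sum_comm (s := Finset.range Y), ← Finset.sum_add_distrib]
    refine Finset.sum_congr rfl fun n _ => ?_
    rw [← Finset.sum_add_distrib]
    refine Finset.sum_congr rfl fun m _ => ?_
    refine rationalTerm_add_rationalTerm (slitPlane_ne_zero hβ) (by push_cast; rfl)
      (by push_cast; rfl) ?_
    exact slitPlane_ne_zero (ofReal_add_ofReal_mul_mem_slitPlane hβ (by positivity) (by positivity)
      (by positivity))
  have hs1 : ∑ n ∈ Finset.range (Y ^ N), 1 / ((n + 1 : ℕ) : ℂ) *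
        (-2 * N * γ - 2 * (Real.log (n + 1 : ℕ) - l) +
          2 * N * ∑' m : ℕ, rationalTerm (2 * N)
            (((((n + 1 : ℕ) : ℝ) ^ 2 : ℝ) : ℂ) * β⁻¹) (m + 1)) =
      (-2 * N * γ + 2 * l) * H (Y ^ N) - 2 * S (Y ^ N) +
      2 * N * ∑ n ∈ Finset.range (Y ^ N), 1 / ((n + 1 : ℕ) : ℂ) *
        ∑ m ∈ Finset.range Y, rationalTerm (2 * N)
          (((((n + 1 : ℕ) : ℝ) ^ 2 : ℝ) : ℂ) * β⁻¹) (m + 1) + 2 * N * R1 Y := by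
    simp only [hsplit1, hH, hS, R1, Finset.mul_sum (Finset.range (Y ^ N))]
    rw [← Finset.sum_sub_distrib, ← Finset.sum_add_distrib, ← Finset.sum_add_distrib]
    exact Finset.sum_congr rfl fun n _ => by ring
  have hs2 : ∑ m ∈ Finset.range Y, 1 / ((m + 1 : ℕ) : ℂ) *
        (-2 * γ - 2 * (N * Real.log (m + 1 : ℕ) + l) +
          2 * ∑' n : ℕ, rationalTerm 2
            (((((m + 1 : ℕ) : ℝ) ^ (2 * N) : ℝ) : ℂ) * β) (n + 1)) =
      (-2 * γ - 2 * l) * H Y - 2 * N * S Y +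
      2 * ∑ m ∈ Finset.range Y, 1 / ((m + 1 : ℕ) : ℂ) *
        ∑ n ∈ Finset.range (Y ^ N), rationalTerm 2
          (((((m + 1 : ℕ) : ℝ) ^ (2 * N) : ℝ) : ℂ) * β) (n + 1) + 2 * R2 Y := by
    simp only [hsplit2, hH, hS, R2, Finset.mul_sum (Finset.range Y)]
    rw [← Finset.sum_sub_distrib, ← Finset.sum_add_distrib, ← Finset.sum_add_distrib]
    exact Finset.sum_congr rfl fun n _ => by ring
  have hlogpow : (Real.log (Y ^ N : ℕ) : ℂ) = N * Real.log Y := by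
    rw [Nat.cast_pow, Real.log_pow]; push_cast; rfl
  rw [hs1, hs2]
  simp only [Function.comp_apply, hlogpow]
  linear_combination -2 * N * hdouble

/-! ### Translation to the Herglotz series and conclusion. -/

theorem herglotzTerm_one_add_symm {N : ℕ} {z : ℂ} (hz : 0 < z.re) (m : ℕ) :
    herglotzTerm 1 N (I * z) (m + 1) + herglotzTerm 1 N (-I * z) (m + 1) =
      1 / ((m + 1 : ℕ) : ℂ) * (-2 * Real.eulerMascheroniConstant -
        2 * (N * Real.log (m + 1 : ℕ) + log z) + 2 * ∑' n : ℕ, rationalTerm 2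
          (((((m + 1 : ℕ) : ℝ) ^ (2 * N) : ℝ) : ℂ) * z ^ 2) (n + 1)) := by
  have hm : (0 : ℝ) < ((m + 1 : ℕ) : ℝ) := by positivity
  set r : ℝ := ((m + 1 : ℕ) : ℝ) ^ N with hr
  have hr0 : 0 < r := by positivity
  have hrz : 0 < ((r : ℂ) * z).re := by
    rw [re_ofReal_mul]; positivity
  have h := digamma_sub_log_symm hrz
  have hz0 : z ≠ 0 := by rintro rfl; simp at hz
  have hlog : log ((r : ℂ) * z) = N * Real.log (m + 1 : ℕ) + log z := by
    rw [log_ofReal_mul hr0 hz0, hr, Real.log_pow]; push_cast; rfl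
  have hsq : ((r : ℂ) * z) ^ 2 = ((((m + 1 : ℕ) : ℝ) ^ (2 * N) : ℝ) : ℂ) * z ^ 2 := by
    rw [hr]; push_cast; ring
  rw [hlog, hsq] at h
  rw [← h, herglotzTerm, herglotzTerm, Real.rpow_natCast, Real.rpow_one, ← hr, ofReal_natCast,
    mul_left_comm (r : ℂ), mul_left_comm (r : ℂ)]
  ring

theorem rootPoint_eq_exp {N : ℕ} {x : ℂ} (hx : x ≠ 0) (m : ℕ) :
    rootPoint N x (2 * (m : ℤ) - ((N : ℤ) - 1)) =
      exp (rootArg N (log (2 * Real.pi / x)) m) := by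
  have h0 : 2 * (Real.pi : ℂ) / x ≠ 0 :=
    div_ne_zero (mul_ne_zero two_ne_zero (ofReal_ne_zero.2 Real.pi_ne_zero)) hx
  rw [rootPoint, cpow_def_of_ne_zero h0, ← exp_add, rootArg]
  congr 1
  ring

/-- Scaling by an `N`-th root shifts `l` by a real logarithm; its imaginary part, and hence the
half-plane condition, is unchanged. -/
theorem ofReal_rpow_mul_exp_rootArg {N : ℕ} (l : ℂ) (m n : ℕ) :
    ((((n + 1 : ℕ) : ℝ) ^ (1 / (N : ℝ)) : ℝ) : ℂ) * exp (rootArg N l m) =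
      exp (rootArg N (Real.log (n + 1 : ℕ) + l) m) := by
  have hn : (0 : ℝ) < ((n + 1 : ℕ) : ℝ) := by positivity
  rw [Real.rpow_def_of_pos hn, ofReal_exp, ← exp_add, rootArg, rootArg]
  congr 1
  push_cast
  ring

theorem sum_herglotzTerm_rootArg {N : ℕ} (hN : Odd N) {l : ℂ} (hl : |l.im| < Real.pi / 2)
    (n : ℕ) :
    ∑ m ∈ Finset.range N, (herglotzTerm 1 (1 / (N : ℝ)) (I * exp (rootArg N (-l) m)) (n + 1) +
      herglotzTerm 1 (1 / (N : ℝ)) (-I * exp (rootArg N (-l) m)) (n + 1)) =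
      1 / ((n + 1 : ℕ) : ℂ) *
        (-2 * N * Real.eulerMascheroniConstant - 2 * (Real.log (n + 1 : ℕ) - l) +
          2 * N * ∑' m : ℕ, rationalTerm (2 * N)
            (((((n + 1 : ℕ) : ℝ) ^ 2 : ℝ) : ℂ) * (exp l ^ 2)⁻¹) (m + 1)) := by
  have hn : (0 : ℝ) < ((n + 1 : ℕ) : ℝ) := by positivity
  have him : |((Real.log (n + 1 : ℕ) : ℂ) + -l).im| < Real.pi / 2 := by
    simpa only [add_im, ofReal_im, neg_im, zero_add, abs_neg] using hl
  have h := sum_digamma_sub_log_rootArg hN him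
  have hexp : exp (2 * (Real.log (n + 1 : ℕ) + -l)) =
      ((((n + 1 : ℕ) : ℝ) ^ 2 : ℝ) : ℂ) * (exp l ^ 2)⁻¹ := by
    rw [two_mul, exp_add, exp_add, ← ofReal_exp, Real.exp_log hn, exp_neg]
    push_cast
    ring
  rw [hexp] at h
  rw [sub_eq_add_neg (Real.log (n + 1 : ℕ) : ℂ), ← h, Finset.mul_sum]
  refine Finset.sum_congr rfl fun m _ => ?_
  rw [herglotzTerm, herglotzTerm, Real.rpow_one, ofReal_natCast, mul_left_comm _ I,
    mul_left_comm _ (-I), ofReal_rpow_mul_exp_rootArg]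
  ring

theorem theorem2p3 (N : ℕ) (hN : Odd N) (x : ℂ) (hx : 0 < x.re) :
    -- all the series involved converge absolutely
    (∀ m ∈ Finset.range N, ∀ j : ℤ, j = 2 * (m : ℤ) - ((N : ℤ) - 1) →
      Summable (fun n : ℕ =>
        herglotzTerm 1 (1 / (N : ℝ)) (Complex.I * rootPoint N x j) (n + 1)) ∧
      Summable (fun n : ℕ =>
        herglotzTerm 1 (1 / (N : ℝ)) (-Complex.I * rootPoint N x j) (n + 1))) ∧
    Summable (fun n : ℕ =>
      herglotzTerm 1 (N : ℝ) (Complex.I * x / (2 * (Real.pi : ℂ))) (n + 1)) ∧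
    Summable (fun n : ℕ =>
      herglotzTerm 1 (N : ℝ) (-(Complex.I * x / (2 * (Real.pi : ℂ)))) (n + 1)) ∧
    -- the functional equation
    stepTwoSum N (fun j =>
        extHerglotz 1 (1 / (N : ℝ)) (Complex.I * rootPoint N x j) +
        extHerglotz 1 (1 / (N : ℝ)) (-Complex.I * rootPoint N x j)) =
      -(N : ℂ) *
        (extHerglotz 1 (N : ℝ) (Complex.I * x / (2 * (Real.pi : ℂ))) +
          extHerglotz 1 (N : ℝ) (-(Complex.I * x / (2 * (Real.pi : ℂ)))) -
          1 / (N : ℂ) *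
            ((Real.pi : ℂ) ^ 2 / 12 - 2 * (N : ℂ) * (Real.eulerMascheroniConstant : ℂ) ^ 2 +
              2 * ((N : ℂ) - 1) * (Real.eulerMascheroniConstant : ℂ) *
                Complex.log (2 * (Real.pi : ℂ) / x) +
              Complex.log (2 * (Real.pi : ℂ)) ^ 2 -
              Complex.log (4 * (Real.pi : ℂ) ^ 2 / x) * Complex.log x -
              2 * ((N : ℂ) ^ 2 + 1) * stieltjesOne)) := by
  have hx0 : x ≠ 0 := by rintro rfl; simp at hx
  have hpi : (Real.pi : ℂ) ≠ 0 := ofReal_ne_zero.2 Real.pi_ne_zero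
  have hN0 : N ≠ 0 := hN.pos.ne'
  have hN' : (N : ℂ) ≠ 0 := by exact_mod_cast hN0
  have hNpos : (0 : ℝ) < N := by exact_mod_cast hN.pos
  have h2pi : (0 : ℝ) < 2 * Real.pi := by positivity
  have hpipos := Real.pi_pos
  set z : ℂ := x / (2 * Real.pi) with hz
  have hzx : z = (((2 * Real.pi)⁻¹ : ℝ) : ℂ) * x := by
    rw [hz]; push_cast; rw [div_eq_inv_mul]
  have hzre : 0 < z.re := by
    rw [hzx, re_ofReal_mul]; positivity
  have hz0 : z ≠ 0 := by rintro h; rw [h] at hzre; simp at hzre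
  have hargz := abs_arg_lt_pi_div_two_iff.2 (Or.inl hzre)
  have hargz' := abs_lt.1 hargz
  set l : ℂ := log z with hl
  have hlim : |l.im| < Real.pi / 2 := by rwa [hl, log_im]
  have hlx : l = log x - log (2 * Real.pi) := by
    rw [hl, hzx, log_ofReal_mul (by positivity) hx0, Real.log_inv, ← ofReal_ofNat, ← ofReal_mul,
      ← ofReal_log h2pi.le]
    push_cast
    ring
  have hlinv : log (2 * Real.pi / x) = -l := by
    rw [hl, ← log_inv _ (by intro h; rw [h] at hargz'; linarith), hz, inv_div]
  -- With this, `log² (2π) - log (4π² / x) log x` becomes the square of `l = log x - log (2π)`.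
  have hlog4 : log (4 * Real.pi ^ 2 / x) = 2 * log (2 * Real.pi) - log x := by
    have h4 : 4 * (Real.pi : ℂ) ^ 2 / x = ((2 * Real.pi : ℝ) : ℂ) * (2 * Real.pi / x) := by
      push_cast; ring
    rw [h4, log_ofReal_mul h2pi (div_ne_zero (mul_ne_zero two_ne_zero hpi) hx0), hlinv, hlx,
      ofReal_log h2pi.le]
    push_cast
    ring
  have hexpl : exp l = z := exp_log hz0
  have hβ := sq_mem_slitPlane hzre
  have hlogβ : log (z ^ 2) = 2 * l := by
    rw [hl, sq, log_mul hz0 hz0 ⟨by linarith, by linarith⟩, two_mul]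
  have hIz : I * x / (2 * Real.pi) = I * z := by rw [hz, mul_div_assoc]
  have hIz' : -(I * z) = -I * z := by ring
  have hroot : ∀ m : ℕ, rootPoint N x (2 * (m : ℤ) - ((N : ℤ) - 1)) = exp (rootArg N (-l) m) :=
    fun m => by rw [rootPoint_eq_exp hx0, hlinv]
  have hrootre : ∀ m ∈ Finset.range N, 0 < (exp (rootArg N (-l) m)).re := fun m hm =>
    exp_rootArg_re_pos (by rwa [neg_im, abs_neg]) (Finset.mem_range.1 hm)
  have hs1 : ∀ m ∈ Finset.range N, Summable fun n : ℕ =>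
      herglotzTerm 1 (1 / (N : ℝ)) (I * exp (rootArg N (-l) m)) (n + 1) := fun m hm =>
    summable_herglotzTerm (by positivity) (I_mul_mem_slitPlane (hrootre m hm))
  have hs2 : ∀ m ∈ Finset.range N, Summable fun n : ℕ =>
      herglotzTerm 1 (1 / (N : ℝ)) (-I * exp (rootArg N (-l) m)) (n + 1) := fun m hm =>
    summable_herglotzTerm (by positivity) (neg_I_mul_mem_slitPlane (hrootre m hm))
  have hs3 : Summable fun n : ℕ => herglotzTerm 1 (N : ℝ) (I * z) (n + 1) :=
    summable_herglotzTerm hNpos (I_mul_mem_slitPlane hzre)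
  have hs4 : Summable fun n : ℕ => herglotzTerm 1 (N : ℝ) (-I * z) (n + 1) :=
    summable_herglotzTerm hNpos (neg_I_mul_mem_slitPlane hzre)
  rw [hIz, hIz']
  refine ⟨?_, hs3, hs4, ?_⟩
  · rintro m hm j rfl
    rw [hroot]
    exact ⟨hs1 m hm, hs2 m hm⟩
  · have hA : HasSum (fun n : ℕ => ∑ m ∈ Finset.range N,
        (herglotzTerm 1 (1 / (N : ℝ)) (I * exp (rootArg N (-l) m)) (n + 1) +
          herglotzTerm 1 (1 / (N : ℝ)) (-I * exp (rootArg N (-l) m)) (n + 1)))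
        (stepTwoSum N (fun j =>
          extHerglotz 1 (1 / (N : ℝ)) (I * rootPoint N x j) +
          extHerglotz 1 (1 / (N : ℝ)) (-I * rootPoint N x j))) := by
      refine hasSum_sum fun m hm => ?_
      simp only [hroot]
      exact (hs1 m hm).hasSum.add (hs2 m hm).hasSum
    have hB : HasSum (fun n : ℕ => herglotzTerm 1 (N : ℝ) (I * z) (n + 1) +
        herglotzTerm 1 (N : ℝ) (-I * z) (n + 1))
        (extHerglotz 1 (N : ℝ) (I * z) + extHerglotz 1 (N : ℝ) (-I * z)) :=
      hs3.hasSum.add hs4.hasSum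
    -- Both series converge, so their partial sums may be taken at the unequal cutoffs `Y ^ N` and
    -- `Y`.
    have hlimit := (hA.tendsto_sum_nat.comp (tendsto_pow_atTop hN0)).add
      (hB.tendsto_sum_nat.const_mul (N : ℂ))
    have hmain := tendsto_rearrangement hN0 hβ hlogβ
    have key := tendsto_nhds_unique (hlimit.congr fun Y => ?_) hmain
    · rw [hlinv, hlog4]
      have hcancel : ∀ a b : ℂ, -(N : ℂ) * (a - 1 / N * b) = -N * a + b := fun a b => by
        field_simp
        ring
      rw [hlx] at key ⊢
      rw [hcancel]
      linear_combination key
    · simp only [Function.comp_apply, sum_herglotzTerm_rootArg hN hlim,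
        herglotzTerm_one_add_symm hzre, hexpl, ← hl]
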